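/- Consider a Fisher market with $n\ge 1$ buyers and $m\ge 1$ divisible goods (one unit of each), where buyer $i$ has budget $B_i\ge 0$, linear utility $\sum_j u_{ij}x_{ij}$ with $u_{ij}\ge 0$, and pays a transaction cost $c_{ij}\ge 0$ per unit of good $j$ in addition to its price $p_j$. For $\epsilon>0$, prices $p_j\ge 0$ and allocations $x_{ij}\ge 0$ with all $p_j+c_{ij}>0$ form an $\epsilon$-approximate equilibrium if, with $\alpha_i=\max_j u_{ij}/(p_j+c_{ij})$, (5) $\sum_j (p_j+c_{ij})x_{ij}=B_i$ for every $i$; (6) $\sum_i x_{ij}\le 1$ for every $j$; (7) $p_j>\epsilon$ implies $\sum_i x_{ij}\ge 1/(1+\epsilon)$, for every $j$; (8) $x_{ij}>0$ implies $u_{ij}\ge \alpha_i(p_j+c_{ij})/(1+\epsilon)$, for all $i,j$. Theorem. There are one algorithm (a program for a real RAM, whose operations are exact addition, subtraction, multiplication, division and comparison of reals, addition, truncated subtraction, halving and comparison of indices, and access to array cells) and one constant $C$ such that, for every such market and every $\epsilon>0$, the algorithm, given $n,m,\epsilon,(B_i),(u_{ij}),(c_{ij})$, halts and outputs prices and allocations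 that form an $\epsilon$-approximate equilibrium, after at most $$C\,(n+\log m)\,m\,n\,\bigl(1+\max\{1,1/\epsilon\}\cdot\max\{0,\log(B/\epsilon)\}\bigr)$$ operations, where $B=(1+\epsilon)\sum_i B_i$. In particular, whenever $\epsilon\le 1$ and $\epsilon\le\sum_i B_i$, the number of operations is at most $$C\cdot\frac1\epsilon\,(n+\log m)\,m\,n\,\log(B/\epsilon).$$ -/

import Mathlib

/-! ### Fisher markets with transaction costs -/

/-- A Fisher market with `n` buyers, `m` divisible goods (one unit of each), linear utilities and
nonnegative transaction costs per unit. -/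
structure FisherMarket (n m : ℕ) where
  /-- the budget of buyer `i` -/
  budget : Fin n → ℝ
  /-- the utility of buyer `i` for one unit of good `j` -/
  util : Fin n → Fin m → ℝ
  /-- the transaction cost that buyer `i` pays per unit of good `j` -/
  tcost : Fin n → Fin m → ℝ
  budget_nonneg : ∀ i, 0 ≤ budget i
  util_nonneg : ∀ i j, 0 ≤ util i j
  tcost_nonneg : ∀ i j, 0 ≤ tcost i j

namespace FisherMarket

variable {n m : ℕ}

/-- The bang-per-buck of buyer `i` at prices `p`: the largest ratio of utility to effective price
(a maximum over the finitely many goods). -/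
noncomputable def bangPerBuck (M : FisherMarket n m) (p : Fin m → ℝ) (i : Fin n) : ℝ :=
  ⨆ j, M.util i j / (p j + M.tcost i j)

/-- Prices `p` and allocations `x` form an `ε`-approximate market equilibrium. The field
`eff_price_pos` says that the ratios that define the bang-per-buck have positive denominators. -/
structure IsApproxEquilibrium (M : FisherMarket n m) (ε : ℝ) (p : Fin m → ℝ)
    (x : Fin n → Fin m → ℝ) : Prop where
  price_nonneg : ∀ j, 0 ≤ p j
  alloc_nonneg : ∀ i j, 0 ≤ x i j
  eff_price_pos : ∀ i j, 0 < p j + M.tcost i j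
  budget_spent : ∀ i, ∑ j, (p j + M.tcost i j) * x i j = M.budget i
  supply : ∀ j, ∑ i, x i j ≤ 1
  approx_clearing : ∀ j, ε < p j → 1 / (1 + ε) ≤ ∑ i, x i j
  approx_optimal : ∀ i j, 0 < x i j →
    M.bangPerBuck p i * (p j + M.tcost i j) / (1 + ε) ≤ M.util i j

end FisherMarket

/-! ### A real RAM with an operation count

A program is a text that does not depend on the input. Its memory consists of two-dimensional
arrays of natural numbers (used as indices) and of real numbers. The exact operations are: for
indices, addition, truncated subtraction, halving and comparison; for reals, addition, subtraction,
multiplication, division and comparison; and reading and writing an array cell at computed indices.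
There is no rounding of reals and no conversion between the two sorts. The only constants are
natural numbers. -/

namespace RealRAM

/-- The memory: `idx a i j` and `real a i j` are the cells `(i, j)` of the arrays number `a`. -/
structure State where
  idx : ℕ → ℕ → ℕ → ℕ
  real : ℕ → ℕ → ℕ → ℝ

/-- Overwrite the cell `(i, j)` of array number `a`. -/
def write {α : Type} (f : ℕ → ℕ → ℕ → α) (a i j : ℕ) (v : α) : ℕ → ℕ → ℕ → α :=
  fun a' i' j' => if a' = a ∧ i' = i ∧ j' = j then v else f a' i' j'

/-- Index expressions. -/
inductive IdxExpr where
  | lit (k : ℕ)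
  | read (a : ℕ) (i j : IdxExpr)
  | add (e f : IdxExpr)
  | sub (e f : IdxExpr)
  | half (e : IdxExpr)

/-- Real expressions. -/
inductive RealExpr where
  | lit (k : ℕ)
  | read (a : ℕ) (i j : IdxExpr)
  | add (e f : RealExpr)
  | sub (e f : RealExpr)
  | mul (e f : RealExpr)
  | div (e f : RealExpr)

/-- Tests. -/
inductive Test where
  | idxLt (e f : IdxExpr)
  | realLt (e f : RealExpr)
  | not (b : Test)
  | and (b c : Test)

/-- Programs. -/
inductive Prog where
  | skip
  | setIdx (a : ℕ) (i j : IdxExpr) (e : IdxExpr)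
  | setReal (a : ℕ) (i j : IdxExpr) (e : RealExpr)
  | seq (P Q : Prog)
  | ite (b : Test) (P Q : Prog)
  | loop (b : Test) (P : Prog)

/-- The value of an index expression. -/
def IdxExpr.eval (s : State) : IdxExpr → ℕ
  | .lit k => k
  | .read a i j => s.idx a (i.eval s) (j.eval s)
  | .add e f => e.eval s + f.eval s
  | .sub e f => e.eval s - f.eval s
  | .half e => e.eval s / 2

/-- The number of operations in an index expression: one for every constant, access and
arithmetic operation. -/
def IdxExpr.cost : IdxExpr → ℕ
  | .lit _ => 1
  | .read _ i j => 1 + i.cost + j.cost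
  | .add e f => 1 + e.cost + f.cost
  | .sub e f => 1 + e.cost + f.cost
  | .half e => 1 + e.cost

/-- The value of a real expression. -/
noncomputable def RealExpr.eval (s : State) : RealExpr → ℝ
  | .lit k => (k : ℝ)
  | .read a i j => s.real a (i.eval s) (j.eval s)
  | .add e f => e.eval s + f.eval s
  | .sub e f => e.eval s - f.eval s
  | .mul e f => e.eval s * f.eval s
  | .div e f => e.eval s / f.eval s

/-- The number of operations in a real expression. -/
def RealExpr.cost : RealExpr → ℕ
  | .lit _ => 1
  | .read _ i j => 1 + i.cost + j.cost
  | .add e f => 1 + e.cost + f.cost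
  | .sub e f => 1 + e.cost + f.cost
  | .mul e f => 1 + e.cost + f.cost
  | .div e f => 1 + e.cost + f.cost

/-- The outcome of a test. -/
def Test.Holds (s : State) : Test → Prop
  | .idxLt e f => e.eval s < f.eval s
  | .realLt e f => e.eval s < f.eval s
  | .not b => ¬ b.Holds s
  | .and b c => b.Holds s ∧ c.Holds s

/-- The number of operations in a test. -/
def Test.cost : Test → ℕ
  | .idxLt e f => 1 + e.cost + f.cost
  | .realLt e f => 1 + e.cost + f.cost
  | .not b => 1 + b.cost
  | .and b c => 1 + b.cost + c.cost

/-- `Exec P s t s'`: the program `P`, started in the memory `s`, halts after `t` operations and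
leaves the memory `s'`. -/
inductive Exec : Prog → State → ℕ → State → Prop where
  | skip (s : State) : Exec .skip s 1 s
  | setIdx (a : ℕ) (i j e : IdxExpr) (s : State) :
      Exec (.setIdx a i j e) s (1 + i.cost + j.cost + e.cost)
        ⟨write s.idx a (i.eval s) (j.eval s) (e.eval s), s.real⟩
  | setReal (a : ℕ) (i j : IdxExpr) (e : RealExpr) (s : State) :
      Exec (.setReal a i j e) s (1 + i.cost + j.cost + e.cost)
        ⟨s.idx, write s.real a (i.eval s) (j.eval s) (e.eval s)⟩
  | seq {P Q : Prog} {s s' s'' : State} {t t' : ℕ} (hP : Exec P s t s') (hQ : Exec Q s' t' s'') :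
      Exec (.seq P Q) s (t + t') s''
  | iteTrue {b : Test} {P Q : Prog} {s s' : State} {t : ℕ} (hb : b.Holds s) (hP : Exec P s t s') :
      Exec (.ite b P Q) s (1 + b.cost + t) s'
  | iteFalse {b : Test} {P Q : Prog} {s s' : State} {t : ℕ} (hb : ¬ b.Holds s)
      (hQ : Exec Q s t s') : Exec (.ite b P Q) s (1 + b.cost + t) s'
  | loopDone {b : Test} {P : Prog} {s : State} (hb : ¬ b.Holds s) :
      Exec (.loop b P) s (1 + b.cost) s
  | loopStep {b : Test} {P : Prog} {s s' s'' : State} {t t' : ℕ} (hb : b.Holds s)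
      (hP : Exec P s t s') (hL : Exec (.loop b P) s' t' s'') :
      Exec (.loop b P) s (1 + b.cost + t + t') s''

/-- The input memory for the market `M` and the accuracy `ε`. Index arrays `0` and `1` hold `n` and
`m` in their cell `(0, 0)`; real array `0` holds `ε` in its cell `(0, 0)`, real array `1` the
budgets in its column `0`, real arrays `2` and `3` the utilities and the transaction costs. Every
other cell is zero. Buyers and goods are numbered from `0`. -/
def input {n m : ℕ} (M : FisherMarket n m) (ε : ℝ) : State where
  idx a i j :=
    if i = 0 ∧ j = 0 then (match a with
      | 0 => n
      | 1 => m
      | _ => 0)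
    else 0
  real a i j :=
    match a with
    | 0 => if i = 0 ∧ j = 0 then ε else 0
    | 1 => if h : i < n ∧ j = 0 then M.budget ⟨i, h.1⟩ else 0
    | 2 => if h : i < n ∧ j < m then M.util ⟨i, h.1⟩ ⟨j, h.2⟩ else 0
    | 3 => if h : i < n ∧ j < m then M.tcost ⟨i, h.1⟩ ⟨j, h.2⟩ else 0
    | _ => 0

/-- The computed prices: column `0` of real array `4`. -/
def outPrice (s : State) (m : ℕ) : Fin m → ℝ := fun j => s.real 4 j 0

/-- The computed allocations: real array `5`. -/
def outAlloc (s : State) (n m : ℕ) : Fin n → Fin m → ℝ := fun i j => s.real 5 i j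

end RealRAM

/-! The algorithm is an auction. All prices start at `ε`, and a fictitious seller owns everything. A
buyer with money buys a good of largest utility per unit of money, at the current price, from
somebody who got it at the previous price, smaller by the factor `1 + ε`, and who is refunded the
money paid. When nobody is left who got a good at its previous price, its price is raised by
`1 + ε`. The state is a `RealRAM.Auction`, kept by `Auction.transfer` and `Auction.raise`. When all
money is spent, every holding was optimal when bought, hence is optimal up to `1 + ε` now, and each
good dearer than `ε` is sold out; `Auction.isApproxEquilibrium` restates the old holdings at current
prices. A good that is raised is sold out at its price, so no price exceeds `B = (1 + ε) ∑ B_i`, and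
each good is raised at most `log (B / ε) / log (1 + ε)` times (`le_maxRaises`, `maxRaises_le`).

Between two raises of a good each holder loses a holding of it at most once, so there are
`O(n)` such events per raise, and `O(n + log m)` operations are available for each. A trade that
uses up no holding hands all the money of the current buyer on to one other buyer. As favourite
goods and holders do not change meanwhile, the money follows the orbit of a map on buyers. It leaves
the market at the seller, or else after `n` such trades it goes around a cycle (`exists_cycle`).
Trading around a cycle could go on for ever, the amounts forming a geometric sequence, so the total
is computed at once, either the sum of that sequence or the amount that uses up a holding
(`Good.circulate`). Thus `O(n)` operations use up a holding or the money of a buyer, and a buyer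
comes to money only when a holding is used up. A raise changes one leaf in the tournament tree of
every buyer, at a cost of `O(log m)` for each (`Good.raisePrice`). The `potential` adds all this up:
`Good.act` shows that each round is paid for by its drop, and `total_loop` turns this into
termination and a bound on the number of operations. -/

namespace RealRAM

/-! ### A calculus of total correctness with an operation count -/

/-- `Total P Q s`: started in `s`, the program `P` halts after some number `t` of operations in a
memory `s'` with `Q t s'`. -/
def Total (P : Prog) (Q : ℕ → State → Prop) (s : State) : Prop :=
  ∃ t s', Exec P s t s' ∧ Q t s'

theorem Total.mono {P : Prog} {Q R : ℕ → State → Prop} {s : State} (h : Total P Q s)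
    (hQR : ∀ t s', Q t s' → R t s') : Total P R s := by
  obtain ⟨t, s', he, hq⟩ := h
  exact ⟨t, s', he, hQR t s' hq⟩

theorem total_skip {Q : ℕ → State → Prop} {s : State} : Total .skip Q s ↔ Q 1 s := by
  constructor
  · rintro ⟨t, s', he, hq⟩
    cases he
    exact hq
  · exact fun h => ⟨_, _, .skip s, h⟩

theorem total_setIdx {a : ℕ} {i j e : IdxExpr} {Q : ℕ → State → Prop} {s : State} :
    Total (.setIdx a i j e) Q s ↔ Q (1 + i.cost + j.cost + e.cost)
      ⟨write s.idx a (i.eval s) (j.eval s) (e.eval s), s.real⟩ := by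
  constructor
  · rintro ⟨t, s', he, hq⟩
    cases he
    exact hq
  · exact fun h => ⟨_, _, .setIdx a i j e s, h⟩

theorem total_setReal {a : ℕ} {i j : IdxExpr} {e : RealExpr} {Q : ℕ → State → Prop} {s : State} :
    Total (.setReal a i j e) Q s ↔ Q (1 + i.cost + j.cost + e.cost)
      ⟨s.idx, write s.real a (i.eval s) (j.eval s) (e.eval s)⟩ := by
  constructor
  · rintro ⟨t, s', he, hq⟩
    cases he
    exact hq
  · exact fun h => ⟨_, _, .setReal a i j e s, h⟩

theorem total_seq {P R : Prog} {Q : ℕ → State → Prop} {s : State} :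
    Total (.seq P R) Q s ↔ Total P (fun t s' => Total R (fun t' s'' => Q (t + t') s'') s') s := by
  constructor
  · rintro ⟨t, s', he, hq⟩
    cases he with
    | seq h1 h2 => exact ⟨_, _, h1, _, _, h2, hq⟩
  · rintro ⟨t, s', h1, t', s'', h2, hq⟩
    exact ⟨_, _, .seq h1 h2, hq⟩

theorem total_ite {b : Test} {P R : Prog} {Q : ℕ → State → Prop} {s : State} :
    Total (.ite b P R) Q s ↔
      (b.Holds s → Total P (fun t s' => Q (1 + b.cost + t) s') s) ∧
      (¬ b.Holds s → Total R (fun t s' => Q (1 + b.cost + t) s') s) := by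
  constructor
  · rintro ⟨t, s', he, hq⟩
    cases he with
    | iteTrue hb h => exact ⟨fun _ => ⟨_, _, h, hq⟩, fun hn => absurd hb hn⟩
    | iteFalse hb h => exact ⟨fun hp => absurd hp hb, fun _ => ⟨_, _, h, hq⟩⟩
  · rintro ⟨h1, h2⟩
    by_cases hb : b.Holds s
    · obtain ⟨t, s', he, hq⟩ := h1 hb
      exact ⟨_, _, .iteTrue hb he, hq⟩
    · obtain ⟨t, s', he, hq⟩ := h2 hb
      exact ⟨_, _, .iteFalse hb he, hq⟩

/-- The loop rule. `I N s` is an invariant that grants the memory `s` an allowance of `N`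
operations; every round has to be paid for out of the allowance, which forces termination. -/
theorem total_loop {b : Test} {P : Prog} (I : ℕ → State → Prop)
    (step : ∀ N s, I N s → b.Holds s →
      Total P (fun t s' => ∃ N', I N' s' ∧ N' + t + 1 + b.cost ≤ N) s)
    {N : ℕ} {s : State} (h0 : I N s) :
    Total (.loop b P) (fun t s' => ∃ N', I N' s' ∧ ¬ b.Holds s' ∧ t + N' ≤ N + 1 + b.cost) s := by
  induction N using Nat.strong_induction_on generalizing s with
  | _ N ih =>
    by_cases hb : b.Holds s
    · obtain ⟨t, s', he, N', hI, hN⟩ := step N s h0 hb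
      obtain ⟨t', s'', he', N'', hI', hb', hN'⟩ := ih N' (by omega) hI
      exact ⟨_, _, .loopStep hb he he', N'', hI', hb', by omega⟩
    · exact ⟨_, _, .loopDone hb, N, h0, hb, by omega⟩

/-- The rule for a loop that runs for rounds `i, …, d - 1`, each of at most `T` operations. -/
theorem total_loop_count {b : Test} {P : Prog} (I : ℕ → State → Prop) (T d : ℕ)
    (test : ∀ i s, I i s → (b.Holds s ↔ i < d))
    (step : ∀ i s, i < d → I i s → Total P (fun t s' => t ≤ T ∧ I (i + 1) s') s)
    {i : ℕ} {s : State} (hi : i ≤ d) (h0 : I i s) :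
    Total (.loop b P)
      (fun t s' => t ≤ (d - i) * (T + 1 + b.cost) + 1 + b.cost ∧ I d s') s := by
  refine (total_loop (fun N s => ∃ k ≤ d, N = (d - k) * (T + 1 + b.cost) ∧ I k s) ?_
    ⟨i, hi, rfl, h0⟩).mono ?_
  · rintro N s ⟨k, hk, rfl, hI⟩ hb
    have hkd := (test k s hI).1 hb
    refine (step k s hkd hI).mono ?_
    rintro t s' ⟨ht, hI'⟩
    refine ⟨_, ⟨k + 1, hkd, rfl, hI'⟩, ?_⟩
    obtain ⟨e, rfl⟩ : ∃ e, d = k + 1 + e := ⟨d - (k + 1), by omega⟩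
    rw [show k + 1 + e - (k + 1) = e by omega, show k + 1 + e - k = e + 1 by omega, add_mul]
    omega
  · rintro t s' ⟨N', ⟨k, hk, rfl, hI⟩, hb, ht⟩
    have : k = d := by
      have := mt (test k s' hI).2 hb
      omega
    subst this
    exact ⟨by simpa using ht, hI⟩

theorem write_same {α : Type} (f : ℕ → ℕ → ℕ → α) (a i j : ℕ) (v : α) (i' j' : ℕ) :
    write f a i j v a i' j' = if i' = i ∧ j' = j then v else f a i' j' := by
  simp [write]

theorem write_other {α : Type} (f : ℕ → ℕ → ℕ → α) {a a' : ℕ} (h : a' ≠ a) (i j : ℕ) (v : α) :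
    write f a i j v a' = f a' := by
  funext i' j'
  simp [write, h]

/-! ### The bookkeeping of the auction -/

/-- The state of the auction for `n` buyers and `m` goods, as functions on `ℕ` of which only the
values at indices in range matter. Good `j` has been raised `e j` times; `y i j` is what buyer `i`
bought of it at the current price `p j`, and `h i j` what buyer `i` bought at the previous price
`p j / (1 + ε)`; `r i` is the unspent money of buyer `i`. Holder number `n` is a fictitious
seller that owns the units nobody has bought. The money `r` may be negative here, because a
payment around a cycle of buyers passes through such states. -/
structure Auction (n m : ℕ) (ε : ℝ) (u c : ℕ → ℕ → ℝ) (B : ℕ → ℝ) (e : ℕ → ℕ) (p : ℕ → ℝ)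
    (y h : ℕ → ℕ → ℝ) (r : ℕ → ℝ) : Prop where
  price : ∀ j < m, p j = ε * (1 + ε) ^ e j
  y_nonneg : ∀ i ≤ n, ∀ j < m, 0 ≤ y i j
  h_nonneg : ∀ i ≤ n, ∀ j < m, 0 ≤ h i j
  y_seller : ∀ j < m, y n j = 0
  h_seller : ∀ j < m, 0 < e j → h n j = 0
  supply : ∀ j < m, ∑ i ∈ Finset.range (n + 1), (y i j + h i j) = 1
  money : ∀ i < n, ∑ j ∈ Finset.range m,
    ((p j + c i j) * y i j + (p j / (1 + ε) + c i j) * h i j) + r i = B i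
  y_best : ∀ i < n, ∀ j < m, 0 < y i j → ∀ j' < m,
    u i j' * (p j + c i j) ≤ u i j * (p j' + c i j')
  h_best : ∀ i < n, ∀ j < m, 0 < h i j → ∀ j' < m,
    u i j' * (p j / (1 + ε) + c i j) ≤ u i j * (p j' + c i j')
  price_le : ∀ j < m, e j = 0 ∨ p j ≤ (1 + ε) * ∑ i ∈ Finset.range n, B i

namespace Auction

variable {n m : ℕ} {ε : ℝ} {u c : ℕ → ℕ → ℝ} {B : ℕ → ℝ} {e : ℕ → ℕ} {p : ℕ → ℝ}
  {y h : ℕ → ℕ → ℝ} {r : ℕ → ℝ}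

theorem price_pos (H : Auction n m ε u c B e p y h r) (hε : 0 < ε) {j : ℕ} (hj : j < m) :
    0 < p j := by
  rw [H.price j hj]
  positivity

/-- Buyer `s` spends `φ` on his best good `j`, taking it from the old holding of `k`, who gets
back what he paid. -/
theorem transfer (H : Auction n m ε u c B e p y h r) (hε : 0 < ε) (hc : ∀ i j, 0 ≤ c i j)
    {s j k : ℕ} (hs : s < n) (hj : j < m) (hk : k ≤ n) {φ q : ℝ} (hφ : 0 ≤ φ)
    (hle : φ ≤ (p j + c s j) * h k j) (hq : q = φ / (p j + c s j))
    (best : ∀ j' < m, u s j' * (p j + c s j) ≤ u s j * (p j' + c s j'))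
    {y' h' : ℕ → ℕ → ℝ} {r' : ℕ → ℝ}
    (hy : ∀ i l, y' i l = y i l + if i = s ∧ l = j then q else 0)
    (hh : ∀ i l, h' i l = h i l - if i = k ∧ l = j then q else 0)
    (hr : ∀ i < n, r' i = r i - (if i = s then φ else 0) +
      if i = k then q * (p j / (1 + ε) + c k j) else 0) :
    Auction n m ε u c B e p y' h' r' := by
  have hpos : 0 < p j + c s j := add_pos_of_pos_of_nonneg (H.price_pos hε hj) (hc s j)
  have hq0 : 0 ≤ q := hq ▸ div_nonneg hφ hpos.le
  have hqh : q ≤ h k j := by rw [hq, div_le_iff₀ hpos]; linarith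
  have hφq : φ = (p j + c s j) * q := by rw [hq]; field_simp
  have hle' : ∀ i l, 0 < h' i l → 0 < h i l := by
    intro i l hl
    rw [hh] at hl
    split_ifs at hl <;> linarith
  refine ⟨H.price, ?_, ?_, ?_, ?_, ?_, ?_, ?_, ?_, H.price_le⟩
  · intro i hi l hl
    have := H.y_nonneg i hi l hl
    rw [hy]
    split_ifs <;> linarith
  · intro i hi l hl
    have := H.h_nonneg i hi l hl
    rw [hh]
    split_ifs with h1
    · rw [h1.1, h1.2]; linarith
    · linarith
  · intro l hl
    rw [hy, H.y_seller l hl, if_neg (by omega), add_zero]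
  · intro l hl hel
    have h0 := H.h_seller l hl hel
    rw [hh, h0]
    split_ifs with h1
    · rw [← h1.1, ← h1.2, h0] at hqh
      linarith
    · simp
  · intro l hl
    rw [← H.supply l hl]
    simp only [hy, hh]
    by_cases hlj : l = j
    · subst hlj
      simp only [and_true]
      have h1 : ∀ i, y i l + (if i = s then q else 0) + (h i l - if i = k then q else 0) =
          y i l + h i l + ((if i = s then q else 0) - if i = k then q else 0) := fun i => by ring
      simp only [h1]
      rw [Finset.sum_add_distrib, Finset.sum_sub_distrib, Finset.sum_ite_eq', Finset.sum_ite_eq',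
        if_pos (Finset.mem_range.2 (by omega)), if_pos (Finset.mem_range.2 (by omega))]
      ring
    · simp [hlj]
  · intro i hi
    rw [← H.money i hi, hr i hi]
    have h1 : ∀ l, (p l + c i l) * y' i l + (p l / (1 + ε) + c i l) * h' i l =
        (p l + c i l) * y i l + (p l / (1 + ε) + c i l) * h i l +
        if l = j then ((p j + c i j) * (if i = s then q else 0) -
          (p j / (1 + ε) + c i j) * (if i = k then q else 0)) else 0 := by
      intro l
      rw [hy, hh]
      by_cases hlj : l = j
      · subst hlj
        simp only [and_true, if_true]
        ring
      · simp [hlj]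
    simp only [h1]
    rw [Finset.sum_add_distrib, Finset.sum_ite_eq', if_pos (Finset.mem_range.2 hj)]
    by_cases his : i = s
    · subst his
      rw [hφq]
      by_cases hik : i = k
      · subst hik
        simp only [if_true]
        ring
      · simp only [hik, if_true, if_false]
        ring
    · by_cases hik : i = k
      · subst hik
        simp only [his, if_true, if_false]
        ring
      · simp only [his, hik, if_false]
        ring
  · intro i hi l hl h0
    by_cases h1 : i = s ∧ l = j
    · rw [h1.1, h1.2]
      exact best
    · rw [hy, if_neg h1, add_zero] at h0
      exact H.y_best i hi l hl h0
  · intro i hi l hl h0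
    exact H.h_best i hi l hl (hle' i l h0)

/-- Once nobody holds units of good `j` bought at its previous price, its price can be raised by
the factor `1 + ε`: all of it has been sold at the current price, which is therefore at most the
total budget. -/
theorem raise (H : Auction n m ε u c B e p y h r) (hε : 0 < ε) (hc : ∀ i j, 0 ≤ c i j)
    (hu : ∀ i j, 0 ≤ u i j) (hr : ∀ i < n, 0 ≤ r i)
    {j : ℕ} (hj : j < m) (h0 : ∀ i ≤ n, h i j = 0)
    {e' : ℕ → ℕ} {p' : ℕ → ℝ} {y' h' : ℕ → ℕ → ℝ}
    (he : e' = fun l => if l = j then e j + 1 else e l)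
    (hp : ∀ l, p' l = if l = j then p j * (1 + ε) else p l)
    (hy : ∀ i ≤ n, ∀ l, y' i l = if l = j then 0 else y i l)
    (hh : ∀ i ≤ n, ∀ l, h' i l = if l = j then y i j else h i l) :
    Auction n m ε u c B e' p' y' h' r := by
  have hpj := H.price_pos hε hj
  have hmono : ∀ l < m, p l ≤ p' l := by
    intro l hl
    rw [hp]
    split_ifs with h1
    · rw [h1]; nlinarith
    · exact le_rfl
  have hε1 : (1 + ε) ≠ 0 := by positivity
  have hterm : ∀ i < n, ∀ l, (p' l + c i l) * y' i l + (p' l / (1 + ε) + c i l) * h' i l =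
      (p l + c i l) * y i l + (p l / (1 + ε) + c i l) * h i l := by
    intro i hi l
    rw [hp, hy i hi.le, hh i hi.le]
    by_cases hlj : l = j
    · subst hlj
      rw [h0 i hi.le]
      simp [hε1]
    · simp [hlj]
  refine ⟨?_, ?_, ?_, ?_, ?_, ?_, ?_, ?_, ?_, ?_⟩
  · intro l hl
    rw [hp, he]
    by_cases hlj : l = j
    · subst hlj
      simp only [if_true]
      rw [H.price l hl]
      ring
    · simp only [hlj, if_false]
      exact H.price l hl
  · intro i hi l hl
    rw [hy i hi]
    split_ifs
    · exact le_rfl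
    · exact H.y_nonneg i hi l hl
  · intro i hi l hl
    rw [hh i hi]
    split_ifs
    · exact H.y_nonneg i hi j hj
    · exact H.h_nonneg i hi l hl
  · intro l hl
    rw [hy n le_rfl]
    split_ifs
    · rfl
    · exact H.y_seller l hl
  · intro l hl hel
    rw [hh n le_rfl]
    by_cases hlj : l = j
    · rw [if_pos hlj]
      exact H.y_seller j hj
    · simp only [he, hlj, if_false] at hel
      rw [if_neg hlj]
      exact H.h_seller l hl hel
  · intro l hl
    rw [← H.supply l hl]
    refine Finset.sum_congr rfl fun i hi => ?_
    have hi' : i ≤ n := by have := Finset.mem_range.1 hi; omega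
    rw [hy i hi', hh i hi']
    by_cases hlj : l = j
    · subst hlj
      simp [h0 i hi']
    · simp [hlj]
  · intro i hi
    rw [← H.money i hi, Finset.sum_congr rfl fun l _ => hterm i hi l]
  · intro i hi l hl hpos l' hl'
    rw [hy i hi.le] at hpos
    by_cases hlj : l = j
    · simp [hlj] at hpos
    · rw [if_neg hlj] at hpos
      rw [hp l, if_neg hlj]
      refine (H.y_best i hi l hl hpos l' hl').trans ?_
      exact mul_le_mul_of_nonneg_left (by linarith [hmono l' hl']) (hu i l)
  · intro i hi l hl hpos l' hl'
    rw [hh i hi.le] at hpos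
    have hm := mul_le_mul_of_nonneg_left
      (show p l' + c i l' ≤ p' l' + c i l' by linarith [hmono l' hl']) (hu i l)
    by_cases hlj : l = j
    · subst hlj
      rw [if_pos rfl] at hpos
      rw [hp l, if_pos rfl, mul_div_assoc, div_self hε1, mul_one]
      exact (H.y_best i hi l hl hpos l' hl').trans hm
    · rw [if_neg hlj] at hpos
      rw [hp l, if_neg hlj]
      exact (H.h_best i hi l hl hpos l' hl').trans hm
  · intro l hl
    by_cases hlj : l = j
    · right
      subst hlj
      rw [hp, if_pos rfl, mul_comm]
      refine mul_le_mul_of_nonneg_left ?_ (by positivity)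
      have hs := H.supply l hl
      rw [Finset.sum_range_succ, H.y_seller l hl, h0 n le_rfl, add_zero, add_zero] at hs
      calc p l = ∑ i ∈ Finset.range n, p l * (y i l + h i l) := by rw [← Finset.mul_sum, hs, mul_one]
        _ ≤ ∑ i ∈ Finset.range n, B i := by
          refine Finset.sum_le_sum fun i hi => ?_
          have hi := Finset.mem_range.1 hi
          have hnn : ∀ l' ∈ Finset.range m, 0 ≤ (p l' + c i l') * y i l' +
              (p l' / (1 + ε) + c i l') * h i l' := by
            intro l' hl'
            have hl' := Finset.mem_range.1 hl'
            have := H.price_pos hε hl'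
            have := hc i l'
            have := H.y_nonneg i hi.le l' hl'
            have := H.h_nonneg i hi.le l' hl'
            positivity
          have h1 := Finset.single_le_sum hnn (Finset.mem_range.2 hl)
          have h2 := H.money i hi
          have h3 := hr i hi
          have h4 := mul_nonneg (hc i l) (H.y_nonneg i hi.le l hl)
          simp only [h0 i hi.le, mul_zero, add_zero] at h1 ⊢
          linarith
    · rcases H.price_le l hl with h1 | h1
      · left
        simp [he, hlj, h1]
      · right
        rw [hp, if_neg hlj]
        exact h1

/-- The opening state: all prices are `ε`, and the seller holds everything. -/
theorem opening (n m : ℕ) (ε : ℝ) (u c : ℕ → ℕ → ℝ) (B : ℕ → ℝ) {p : ℕ → ℝ}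
    {h : ℕ → ℕ → ℝ} (hp : ∀ j < m, p j = ε)
    (hh : ∀ i ≤ n, ∀ j < m, h i j = if i = n then 1 else 0) :
    Auction n m ε u c B (fun _ => 0) p (fun _ _ => 0) h B := by
  refine ⟨by simpa using hp, by simp, ?_, by simp, by simp, ?_, ?_, by simp, ?_, by simp⟩
  · intro i hi j hj
    rw [hh i hi j hj]
    split_ifs <;> simp
  · intro j hj
    rw [Finset.sum_congr rfl (g := fun i => if i = n then (1 : ℝ) else 0)]
    · simp
    · intro i hi
      rw [hh i (by have := Finset.mem_range.1 hi; omega) j hj, zero_add]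
  · intro i hi
    rw [Finset.sum_eq_zero, zero_add]
    intro j hj
    rw [hh i hi.le j (Finset.mem_range.1 hj), if_neg hi.ne]
    simp
  · intro i hi j hj h0
    rw [hh i hi.le j hj, if_neg hi.ne] at h0
    exact absurd h0 (lt_irrefl 0)

end Auction

/-- When all money has been spent, converting the holdings bought at the previous price into
current units of the same money value gives an approximate equilibrium. -/
theorem Auction.isApproxEquilibrium {n m : ℕ} (hm : 1 ≤ m) (M : FisherMarket n m) {ε : ℝ}
    (hε : 0 < ε) {u c : ℕ → ℕ → ℝ} {B : ℕ → ℝ} {e : ℕ → ℕ} {p : ℕ → ℝ} {y h : ℕ → ℕ → ℝ}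
    {r : ℕ → ℝ} (H : Auction n m ε u c B e p y h r) (hr : ∀ i < n, r i = 0)
    (hu : ∀ (i : Fin n) (j : Fin m), u i j = M.util i j)
    (hc : ∀ (i : Fin n) (j : Fin m), c i j = M.tcost i j)
    (hB : ∀ i : Fin n, B i = M.budget i) {x : ℕ → ℕ → ℝ}
    (hx : ∀ i < n, ∀ j < m,
      x i j = y i j + h i j * ((p j / (1 + ε) + c i j) / (p j + c i j))) :
    M.IsApproxEquilibrium ε (fun j => p j) (fun i j => x i j) := by
  have hp : ∀ j : Fin m, 0 < p j := fun j => H.price_pos hε j.2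
  have hc0 : ∀ (i : Fin n) (j : Fin m), 0 ≤ c i j := fun i j => hc i j ▸ M.tcost_nonneg i j
  have hpc : ∀ (i : Fin n) (j : Fin m), 0 < p j + c i j := fun i j =>
    add_pos_of_pos_of_nonneg (hp j) (hc0 i j)
  have hpc' : ∀ (i : Fin n) (j : Fin m), 0 < p j / (1 + ε) + c i j := fun i j =>
    add_pos_of_pos_of_nonneg (div_pos (hp j) (by linarith)) (hc0 i j)
  have hy0 : ∀ (i : Fin n) (j : Fin m), 0 ≤ y i j := fun i j => H.y_nonneg i i.2.le j j.2
  have hh0 : ∀ (i : Fin n) (j : Fin m), 0 ≤ h i j := fun i j => H.h_nonneg i i.2.le j j.2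
  have hx' : ∀ (i : Fin n) (j : Fin m),
      x i j = y i j + h i j * ((p j / (1 + ε) + c i j) / (p j + c i j)) :=
    fun i j => hx i i.2 j j.2
  -- the conversion factor lies between `1 / (1 + ε)` and `1`
  have hconv : ∀ (i : Fin n) (j : Fin m), (p j / (1 + ε) + c i j) / (p j + c i j) ≤ 1 := by
    intro i j
    rw [div_le_one (hpc i j)]
    have : p j / (1 + ε) ≤ p j := div_le_self (hp j).le (by linarith)
    linarith
  have hconv' : ∀ (i : Fin n) (j : Fin m), p j + c i j ≤ (1 + ε) * (p j / (1 + ε) + c i j) := by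
    intro i j
    have h1 : (1 + ε) * (p j / (1 + ε) + c i j) = p j + c i j + ε * c i j := by
      field_simp
      ring
    rw [h1]
    nlinarith [hc0 i j]
  have hsup : ∀ j : Fin m, ∑ i : Fin n, (y i j + h i j) + h n j = 1 := by
    intro j
    have h1 := H.supply j j.2
    rw [Finset.sum_range_succ, H.y_seller j j.2, zero_add, Finset.sum_range] at h1
    exact h1
  refine ⟨fun j => (hp j).le, ?_, ?_, ?_, ?_, ?_, ?_⟩
  · intro i j
    show 0 ≤ x i j
    rw [hx' i j]
    exact add_nonneg (hy0 i j) (mul_nonneg (hh0 i j) (div_pos (hpc' i j) (hpc i j)).le)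
  · intro i j
    rw [← hc]
    exact hpc i j
  · intro i
    have h1 := H.money i i.2
    rw [hr i i.2, add_zero, hB, Finset.sum_range] at h1
    rw [← h1]
    refine Finset.sum_congr rfl fun j _ => ?_
    rw [← hc, hx' i j]
    have := (hpc i j).ne'
    field_simp
  · intro j
    have h1 := hsup j
    have h2 := H.h_nonneg n le_rfl j j.2
    calc ∑ i : Fin n, x i j ≤ ∑ i : Fin n, (y i j + h i j) := by
          refine Finset.sum_le_sum fun i _ => ?_
          rw [hx' i j]
          have := mul_le_mul_of_nonneg_left (hconv i j) (hh0 i j)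
          linarith
      _ ≤ 1 := by linarith
  · intro j hj
    have he : 0 < e j := by
      rcases Nat.eq_zero_or_pos (e j) with h0 | h0
      · have := H.price j j.2
        rw [h0, pow_zero, mul_one] at this
        linarith
      · exact h0
    have h1 := hsup j
    rw [H.h_seller j j.2 he, add_zero] at h1
    have h2 : 1 / (1 + ε) = ∑ i : Fin n, (y i j + h i j) / (1 + ε) := by
      rw [← Finset.sum_div, h1]
    rw [h2]
    refine Finset.sum_le_sum fun i _ => ?_
    rw [hx' i j, add_div]
    refine add_le_add (div_le_self (hy0 i j) (by linarith)) ?_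
    rw [div_eq_mul_one_div]
    refine mul_le_mul_of_nonneg_left ?_ (hh0 i j)
    rw [div_le_div_iff₀ (by linarith) (hpc i j)]
    linarith [hconv' i j]
  · intro i j hpos
    have hpos : 0 < x i j := hpos
    have hbest : ∀ j' : Fin m,
        u i j' * (p j / (1 + ε) + c i j) ≤ u i j * (p j' + c i j') := by
      intro j'
      rcases (hh0 i j).lt_or_eq with h0 | h0
      · exact H.h_best i i.2 j j.2 h0 j' j'.2
      · have h1 : 0 < y i j := by simpa [hx' i j, ← h0] using hpos
        refine le_trans ?_ (H.y_best i i.2 j j.2 h1 j' j'.2)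
        refine mul_le_mul_of_nonneg_left ?_ (hu i j' ▸ M.util_nonneg i j')
        have : p j / (1 + ε) ≤ p j := div_le_self (hp j).le (by linarith)
        linarith
    have : Nonempty (Fin m) := ⟨⟨0, hm⟩⟩
    have h1 : M.bangPerBuck (fun j => p j) i ≤ u i j / (p j / (1 + ε) + c i j) := by
      refine ciSup_le fun j' => ?_
      rw [← hu, ← hc, div_le_div_iff₀ (hpc i j') (hpc' i j)]
      exact hbest j'
    rw [← hc, ← hu, div_le_iff₀ (by linarith)]
    calc M.bangPerBuck (fun j => p j) i * (p j + c i j)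
        ≤ u i j / (p j / (1 + ε) + c i j) * (p j + c i j) :=
          mul_le_mul_of_nonneg_right h1 (hpc i j).le
      _ ≤ u i j / (p j / (1 + ε) + c i j) * ((1 + ε) * (p j / (1 + ε) + c i j)) :=
          mul_le_mul_of_nonneg_left (hconv' i j)
            (div_nonneg (hu i j ▸ M.util_nonneg i j) (hpc' i j).le)
      _ = u i j * (1 + ε) := by
          rw [mul_comm (1 + ε), ← mul_assoc, div_mul_cancel₀ _ (hpc' i j).ne']

/-! ### Tournament trees -/

/-- In a tournament tree over `m` goods, the node `v` has the children `2 * v` and `2 * v + 1`, the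
root is `1`, the leaf of good `j` is `m + j`, and `W v` is the winner at `v`. All matches but those
at `v₀` and above it are required to be right: the winner is at least as good, in the order given
by `val`, as the winners of both children. With `v₀ = 0` no match is exempt. -/
structure Tournament (m : ℕ) (val : ℕ → ℝ) (W : ℕ → ℕ) (v₀ : ℕ) : Prop where
  lt : ∀ v, 1 ≤ v → v < 2 * m → W v < m
  above : ∀ v, 1 ≤ v → v < 2 * m → ∃ d, (m + W v) / 2 ^ d = v
  left : ∀ v, 1 ≤ v → v < m → (∀ d, v₀ / 2 ^ d ≠ v) → val (W (2 * v)) ≤ val (W v)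
  right : ∀ v, 1 ≤ v → v < m → (∀ d, v₀ / 2 ^ d ≠ v) → val (W (2 * v + 1)) ≤ val (W v)

namespace Tournament

variable {m : ℕ} {val val' : ℕ → ℝ} {W W' : ℕ → ℕ} {v₀ : ℕ}

theorem leaf (H : Tournament m val W v₀) {j : ℕ} (hj : j < m) : W (m + j) = j := by
  obtain ⟨d, hd⟩ := H.above (m + j) (by omega) (by omega)
  have hlt := H.lt (m + j) (by omega) (by omega)
  cases d with
  | zero =>
    rw [pow_zero, Nat.div_one] at hd
    omega
  | succ d =>
    have h1 : (m + W (m + j)) / 2 ^ (d + 1) ≤ (m + W (m + j)) / 2 :=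
      Nat.div_le_div_left (by rw [pow_succ]; have := Nat.one_le_two_pow (n := d); omega) (by omega)
    omega

theorem root_lt (H : Tournament m val W v₀) (hm : 1 ≤ m) : W 1 < m :=
  H.lt 1 le_rfl (by omega)

theorem le_root (H : Tournament m val W 0) {j : ℕ} (hj : j < m) : val j ≤ val (W 1) := by
  have key : ∀ v, 1 ≤ v → v < 2 * m → val (W v) ≤ val (W 1) := by
    intro v
    induction v using Nat.strong_induction_on with
    | _ v ih =>
      intro h1 h2
      rcases h1.eq_or_lt with h | h
      · rw [← h]
      · refine le_trans ?_ (ih (v / 2) (by omega) (by omega) (by omega))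
        have h0 : ∀ d, 0 / 2 ^ d ≠ v / 2 := by
          intro d
          rw [Nat.zero_div]
          omega
        rcases Nat.mod_two_eq_zero_or_one v with hv | hv
        · have := H.left (v / 2) (by omega) (by omega) h0
          rwa [show 2 * (v / 2) = v by omega] at this
        · have := H.right (v / 2) (by omega) (by omega) h0
          rwa [show 2 * (v / 2) + 1 = v by omega] at this
  have := key (m + j) (by omega) (by omega)
  rwa [H.leaf hj] at this

/-- A change of the value of `j` can only spoil the matches above the leaf of `j`. -/
theorem change (H : Tournament m val W 0) {j : ℕ}
    (hval : ∀ l < m, l ≠ j → val' l = val l) : Tournament m val' W ((m + j) / 2) := by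
  have hW : ∀ v, 1 ≤ v → v < m → (∀ d, (m + j) / 2 / 2 ^ d ≠ v) →
      ∀ v', (v' = v ∨ v' / 2 = v) → v' < 2 * m → val' (W v') = val (W v') := by
    intro v h1 h2 h3 v' hv' hlt
    refine hval _ (H.lt v' (by omega) hlt) fun heq => ?_
    obtain ⟨d, hd⟩ := H.above v' (by omega) hlt
    rw [heq] at hd
    rcases hv' with rfl | hv'
    · cases d with
      | zero =>
        rw [pow_zero, Nat.div_one] at hd
        omega
      | succ d =>
        rw [pow_succ', ← Nat.div_div_eq_div_mul] at hd
        exact h3 d hd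
    · refine h3 d ?_
      rw [Nat.div_div_eq_div_mul, mul_comm, ← Nat.div_div_eq_div_mul, hd, hv']
  have h0 : ∀ v, 1 ≤ v → ∀ d, 0 / 2 ^ d ≠ v := by
    intro v hv d
    rw [Nat.zero_div]
    omega
  refine ⟨H.lt, H.above, fun v h1 h2 h3 => ?_, fun v h1 h2 h3 => ?_⟩
  · rw [hW v h1 h2 h3 v (Or.inl rfl) (by omega), hW v h1 h2 h3 (2 * v) (by omega) (by omega)]
    exact H.left v h1 h2 (h0 v h1)
  · rw [hW v h1 h2 h3 v (Or.inl rfl) (by omega), hW v h1 h2 h3 (2 * v + 1) (by omega) (by omega)]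
    exact H.right v h1 h2 (h0 v h1)

/-- Replaying the match at `v`. -/
theorem replay (H : Tournament m val W v₀) (h1 : 1 ≤ v₀) (h2 : v₀ < m)
    (hW : W' = fun v => if v = v₀ then
      (if val (W (2 * v₀)) < val (W (2 * v₀ + 1)) then W (2 * v₀ + 1) else W (2 * v₀)) else W v) :
    Tournament m val W' (v₀ / 2) := by
  have hsel : W' v₀ = W (2 * v₀ + 1) ∨ W' v₀ = W (2 * v₀) := by
    rw [hW]
    simp only [if_true]
    split_ifs <;> simp
  have hne : ∀ v, v ≠ v₀ → W' v = W v := by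
    intro v hv
    rw [hW]
    simp [hv]
  have hpar : ∀ v, 1 ≤ v → (∀ d, v₀ / 2 / 2 ^ d ≠ v) → v ≠ v₀ → ∀ d, v₀ / 2 ^ d ≠ v := by
    intro v _ hv hvv d
    cases d with
    | zero => simpa using hvv.symm
    | succ d =>
      rw [pow_succ', ← Nat.div_div_eq_div_mul]
      exact hv d
  refine ⟨?_, ?_, ?_, ?_⟩
  · intro v hv1 hv2
    by_cases hv : v = v₀
    · subst hv
      rcases hsel with h | h <;> rw [h] <;> exact H.lt _ (by omega) (by omega)
    · rw [hne v hv]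
      exact H.lt v hv1 hv2
  · intro v hv1 hv2
    by_cases hv : v = v₀
    · subst hv
      rcases hsel with h | h
      · obtain ⟨d, hd⟩ := H.above (2 * v + 1) (by omega) (by omega)
        refine ⟨d + 1, ?_⟩
        rw [h, pow_succ, ← Nat.div_div_eq_div_mul, hd]
        omega
      · obtain ⟨d, hd⟩ := H.above (2 * v) (by omega) (by omega)
        refine ⟨d + 1, ?_⟩
        rw [h, pow_succ, ← Nat.div_div_eq_div_mul, hd]
        omega
    · rw [hne v hv]
      exact H.above v hv1 hv2
  · intro v hv1 hv2 hv3
    have hc : 2 * v ≠ v₀ := fun h => hv3 0 (by rw [pow_zero, Nat.div_one]; omega)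
    rw [hne _ hc]
    by_cases hv : v = v₀
    · subst hv
      rw [hW]
      simp only [if_true]
      split_ifs with h
      · exact h.le
      · exact le_rfl
    · rw [hne v hv]
      exact H.left v hv1 hv2 (hpar v hv1 hv3 hv)
  · intro v hv1 hv2 hv3
    have hc : 2 * v + 1 ≠ v₀ := fun h => hv3 0 (by rw [pow_zero, Nat.div_one]; omega)
    rw [hne _ hc]
    by_cases hv : v = v₀
    · subst hv
      rw [hW]
      simp only [if_true]
      split_ifs with h
      · exact le_rfl
      · exact not_lt.1 h
    · rw [hne v hv]
      exact H.right v hv1 hv2 (hpar v hv1 hv3 hv)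

end Tournament

/-! ### Walks that close up -/

/-- A walk of `N ≥ n` steps along a map, all of whose vertices are below `n`, has reached a cycle:
its end `F^[N] a` returns to itself for the first time after some `d ≤ n` steps, and everything
that is visited from there on satisfies what the vertices of the walk satisfy. -/
theorem exists_cycle (F : ℕ → ℕ) (P : ℕ → Prop) {a n N : ℕ} (hN : n ≤ N)
    (hP : ∀ i < N, F^[i] a < n ∧ P (F^[i] a)) (hend : F^[N] a < n) :
    ∃ d, 0 < d ∧ d ≤ n ∧ F^[d] (F^[N] a) = F^[N] a ∧
      (∀ i, 0 < i → i < d → F^[i] (F^[N] a) ≠ F^[N] a) ∧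
      Set.InjOn (fun i => F^[i] (F^[N] a)) (Set.Iio d) ∧
      ∀ i, F^[i] (F^[N] a) < n ∧ P (F^[i] (F^[N] a)) := by
  obtain ⟨i₁, i₂, hlt, hle, heq⟩ : ∃ i₁ i₂, i₁ < i₂ ∧ i₂ ≤ n ∧ F^[i₁] a = F^[i₂] a := by
    have hmaps : Set.MapsTo (fun i => F^[i] a) (Finset.range (n + 1)) (Finset.range n) := by
      intro i hi
      have hi := Finset.mem_range.1 hi
      refine Finset.mem_coe.2 (Finset.mem_range.2 ?_)
      rcases Nat.lt_or_ge i N with h | h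
      · exact (hP i h).1
      · have : i = N := by omega
        rw [this]
        exact hend
    obtain ⟨x, hx, z, hz, hxz, he⟩ :=
      Finset.exists_ne_map_eq_of_card_lt_of_maps_to (by simp) hmaps
    have hx := Finset.mem_range.1 hx
    have hz := Finset.mem_range.1 hz
    rcases lt_or_gt_of_ne hxz with h | h
    · exact ⟨x, z, h, by omega, he⟩
    · exact ⟨z, x, h, by omega, he.symm⟩
  have hper : ∀ l, i₁ ≤ l → F^[l + (i₂ - i₁)] a = F^[l] a := by
    intro l hl
    rw [show l + (i₂ - i₁) = (l - i₁) + i₂ by omega, Function.iterate_add_apply, ← heq,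
      ← Function.iterate_add_apply, show l - i₁ + i₁ = l by omega]
  have hall : ∀ l, ∃ i < N, F^[l] a = F^[i] a := by
    intro l
    induction l using Nat.strong_induction_on with
    | _ l ih =>
      rcases Nat.lt_or_ge l i₂ with h | h
      · exact ⟨l, by omega, rfl⟩
      · obtain ⟨i, hi, he⟩ := ih (l - (i₂ - i₁)) (by omega)
        refine ⟨i, hi, ?_⟩
        rw [← he, ← hper (l - (i₂ - i₁)) (by omega), show l - (i₂ - i₁) + (i₂ - i₁) = l by omega]
  have hp : Function.IsPeriodicPt F (i₂ - i₁) (F^[N] a) := by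
    rw [Function.IsPeriodicPt, Function.IsFixedPt, ← Function.iterate_add_apply, add_comm]
    exact hper N (by omega)
  refine ⟨Function.minimalPeriod F (F^[N] a), hp.minimalPeriod_pos (by omega),
    (hp.minimalPeriod_le (by omega)).trans (by omega), Function.isPeriodicPt_minimalPeriod _ _,
    ?_, Function.iterate_injOn_Iio_minimalPeriod, ?_⟩
  · intro i h1 h2 h3
    exact absurd (Function.IsPeriodicPt.minimalPeriod_le (f := F) h1 h3) (by omega)
  · intro i
    rw [← Function.iterate_add_apply]
    obtain ⟨l, hl, he⟩ := hall (i + N)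
    rw [he]
    exact hP l hl

attribute [simp] IdxExpr.eval RealExpr.eval IdxExpr.cost RealExpr.cost Test.Holds Test.cost
  total_skip total_setIdx total_setReal total_seq total_ite write_same write_other

/-! ### The program

The memory beside the input: index array `4` holds in its column `0` for every good the position in
the list of holders, index array `5` in its row `i` the tournament tree of buyer `i`; the index
scalars are `2` (the current buyer), `3` (the number of trades that have handed the money on since
the last other event), `6` and `7` (the located good and its holder), `8` and `9` (loop counters,
tree nodes) and `10` (the start of a cycle). Real array `1` holds the unspent money, which at first
is the budget, `4` the prices, `5` and `6` the holdings bought at the current and at the previous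
prices, with row `n` for the fictitious seller; the real scalars are `7` (an amount of money), `8`
(a bound for it) and `9` (a quantity). -/

/-- The index scalar number `a`, kept in cell `(0, 0)` of index array `a`. -/
abbrev idxVar (a : ℕ) : IdxExpr := .read a (.lit 0) (.lit 0)

/-- The real scalar number `a`, kept in cell `(0, 0)` of real array `a`. -/
abbrev realVar (a : ℕ) : RealExpr := .read a (.lit 0) (.lit 0)

/-- Assignment to an index scalar. -/
abbrev setIdxVar (a : ℕ) (e : IdxExpr) : Prog := .setIdx a (.lit 0) (.lit 0) e

/-- Assignment to a real scalar. -/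
abbrev setRealVar (a : ℕ) (e : RealExpr) : Prog := .setReal a (.lit 0) (.lit 0) e

/-- Increment of an index scalar. -/
abbrev incr (a : ℕ) : Prog := setIdxVar a (.add (idxVar a) (.lit 1))

/-- The price of good `j` plus the transaction cost of buyer `i`. -/
abbrev effPrice (i j : IdxExpr) : RealExpr := .add (.read 4 j (.lit 0)) (.read 3 i j)

/-- The same with the previous price of good `j`. -/
abbrev oldEffPrice (i j : IdxExpr) : RealExpr :=
  .add (.div (.read 4 j (.lit 0)) (.add (.lit 1) (realVar 0))) (.read 3 i j)

/-- The utility per unit of money of good `j` for buyer `i`. -/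
abbrev ratio (i j : IdxExpr) : RealExpr := .div (.read 2 i j) (effPrice i j)

/-- Find the favourite good of the current buyer and the holder to take it from. -/
def locate : Prog :=
  .seq (setIdxVar 6 (.read 5 (idxVar 2) (.lit 1))) (setIdxVar 7 (.read 4 (idxVar 6) (.lit 0)))

/-- The current buyer spends the amount in scalar `7` on the located good, taking it from the
located holder; afterwards scalar `7` is the refund of that holder. -/
def transfer : Prog :=
  .seq (setRealVar 9 (.div (realVar 7) (effPrice (idxVar 2) (idxVar 6)))) <|
  .seq (.setReal 5 (idxVar 2) (idxVar 6) (.add (.read 5 (idxVar 2) (idxVar 6)) (realVar 9))) <|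
  .seq (.setReal 6 (idxVar 7) (idxVar 6) (.sub (.read 6 (idxVar 7) (idxVar 6)) (realVar 9))) <|
  .seq (.setReal 1 (idxVar 2) (.lit 0) (.sub (.read 1 (idxVar 2) (.lit 0)) (realVar 7))) <|
  .seq (setRealVar 7 (.mul (realVar 9) (oldEffPrice (idxVar 7) (idxVar 6))))
  (.setReal 1 (idxVar 7) (.lit 0) (.add (.read 1 (idxVar 7) (.lit 0)) (realVar 7)))

/-- The money that the current buyer can spend on the holding located. -/
abbrev capacity : RealExpr :=
  .mul (effPrice (idxVar 2) (idxVar 6)) (.read 6 (idxVar 7) (idxVar 6))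

/-- The current buyer spends as much as possible on the holding located. If that leaves part of
the holding, its owner becomes the current buyer. -/
def trade : Prog :=
  .ite (.realLt (.read 1 (idxVar 2) (.lit 0)) capacity)
    (.seq (setRealVar 7 (.read 1 (idxVar 2) (.lit 0))) <| .seq transfer <|
      .seq (setIdxVar 2 (idxVar 7)) (incr 3))
    (.seq (setRealVar 7 capacity) <| .seq transfer (setIdxVar 3 (.lit 0)))

/-- One step along the walk from a buyer to the holder of the buyer's favourite good, without
trading. Scalar `7` is the money passed on, scalar `8` the factor by which the money at the start
of the walk can be multiplied. -/
def probe : Prog :=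
  .seq locate <|
  .seq (setRealVar 9 (.div (realVar 7) (effPrice (idxVar 2) (idxVar 6)))) <|
  .seq (.ite (.realLt (.read 6 (idxVar 7) (idxVar 6)) (.mul (realVar 8) (realVar 9)))
    (setRealVar 8 (.div (.read 6 (idxVar 7) (idxVar 6)) (realVar 9))) .skip) <|
  .seq (setRealVar 7 (.mul (realVar 9) (oldEffPrice (idxVar 7) (idxVar 6))))
  (setIdxVar 2 (idxVar 7))

/-- One step along the same walk, with trading. -/
def push : Prog := .seq locate <| .seq transfer (setIdxVar 2 (idxVar 7))

/-- The current buyer is not the one where the walk started. -/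
abbrev away : Test :=
  .not (.and (.not (.idxLt (idxVar 2) (idxVar 10))) (.not (.idxLt (idxVar 10) (idxVar 2))))

/-- Walk around a cycle. -/
abbrev around (P : Prog) : Prog := .seq P (.loop away P)

/-- The amount to send around the cycle: the most that the holdings allow, unless the money of the
current buyer is used up earlier. -/
def chooseAmount : Prog :=
  .ite (.and (.realLt (realVar 7) (.lit 1))
      (.realLt (.read 1 (idxVar 2) (.lit 0)) (.mul (realVar 8) (.sub (.lit 1) (realVar 7)))))
    (setRealVar 7 (.div (.read 1 (idxVar 2) (.lit 0)) (.sub (.lit 1) (realVar 7))))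
    (setRealVar 7 (realVar 8))

/-- Trade around the cycle on which the current buyer lies, until a holding or the money of the
current buyer is used up. -/
def circulate : Prog :=
  .seq (setIdxVar 10 (idxVar 2)) <| .seq (setRealVar 7 (.lit 1)) <|
  .seq (setRealVar 8 capacity) <| .seq (around probe) <| .seq chooseAmount <|
  .seq (around push) (setIdxVar 3 (.lit 0))

/-- Replay the match at the node in scalar `9` of the tournament of the buyer in scalar `8`. -/
def replayMatch : Prog :=
  .ite (.realLt
      (ratio (idxVar 8) (.read 5 (idxVar 8) (.add (idxVar 9) (idxVar 9))))
      (ratio (idxVar 8) (.read 5 (idxVar 8) (.add (.add (idxVar 9) (idxVar 9)) (.lit 1)))))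
    (.setIdx 5 (idxVar 8) (idxVar 9)
      (.read 5 (idxVar 8) (.add (.add (idxVar 9) (idxVar 9)) (.lit 1))))
    (.setIdx 5 (idxVar 8) (idxVar 9) (.read 5 (idxVar 8) (.add (idxVar 9) (idxVar 9))))

/-- Replay all matches from a node up to the root. -/
def replayUp : Prog :=
  .loop (.idxLt (.lit 0) (idxVar 9)) (.seq replayMatch (setIdxVar 9 (.half (idxVar 9))))

/-- Raise the price of the located good. -/
def raisePrice : Prog :=
  .seq (.setReal 4 (idxVar 6) (.lit 0)
    (.mul (.read 4 (idxVar 6) (.lit 0)) (.add (.lit 1) (realVar 0)))) <|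
  .seq (.setIdx 4 (idxVar 6) (.lit 0) (.lit 0)) <|
  .seq (setIdxVar 3 (.lit 0)) <|
  .seq (setIdxVar 8 (.lit 0)) <|
  .loop (.idxLt (idxVar 8) (idxVar 0)) <|
    .seq (.setReal 6 (idxVar 8) (idxVar 6) (.read 5 (idxVar 8) (idxVar 6))) <|
    .seq (.setReal 5 (idxVar 8) (idxVar 6) (.lit 0)) <|
    .seq (setIdxVar 9 (.half (.add (idxVar 1) (idxVar 6)))) <|
    .seq replayUp (incr 8)

/-- The current buyer is a buyer with money. -/
abbrev hasMoney : Test :=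
  .and (.idxLt (idxVar 2) (idxVar 0)) (.realLt (.lit 0) (.read 1 (idxVar 2) (.lit 0)))

/-- Make the first buyer with money the current buyer. -/
def rescan : Prog :=
  .seq (setIdxVar 3 (.lit 0)) <| .seq (setIdxVar 2 (.lit 0)) <|
  .loop (.and (.idxLt (idxVar 2) (idxVar 0))
    (.not (.realLt (.lit 0) (.read 1 (idxVar 2) (.lit 0))))) (incr 2)

/-- Proceed to the next holder of the located good. -/
def advance : Prog :=
  .seq (.setIdx 4 (idxVar 6) (.lit 0) (.add (idxVar 7) (.lit 1))) (setIdxVar 3 (.lit 0))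

/-- What the current buyer does in one round. -/
def act : Prog :=
  .seq locate <| .ite (.idxLt (idxVar 0) (idxVar 7)) raisePrice <|
    .ite (.realLt (.lit 0) (.read 6 (idxVar 7) (idxVar 6)))
      (.ite (.idxLt (idxVar 3) (idxVar 0)) trade circulate) advance

/-- The auction proper. -/
def auction : Prog :=
  .loop (.idxLt (idxVar 2) (idxVar 0)) (.seq act (.ite hasMoney .skip rescan))

/-- Set up the prices, the holdings of the seller, and the tournaments. -/
def setUp : Prog :=
  .seq (.loop (.idxLt (idxVar 8) (idxVar 1)) <|
    .seq (.setReal 4 (idxVar 8) (.lit 0) (realVar 0)) <|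
    .seq (.setReal 6 (idxVar 0) (idxVar 8) (.lit 1)) (incr 8)) <|
  .seq (setIdxVar 8 (.lit 0)) <|
  .loop (.idxLt (idxVar 8) (idxVar 0)) <|
    .seq (setIdxVar 9 (.lit 0)) <|
    .seq (.loop (.idxLt (idxVar 9) (idxVar 1)) <|
      .seq (.setIdx 5 (idxVar 8) (.add (idxVar 1) (idxVar 9)) (idxVar 9)) (incr 9)) <|
    .seq (setIdxVar 9 (.sub (idxVar 1) (.lit 1))) <|
    .seq (.loop (.idxLt (.lit 0) (idxVar 9)) <|
      .seq replayMatch (setIdxVar 9 (.sub (idxVar 9) (.lit 1))))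
    (incr 8)

/-- Express the holdings bought at previous prices in units at current prices. -/
def settle : Prog :=
  .seq (setIdxVar 8 (.lit 0)) <|
  .loop (.idxLt (idxVar 8) (idxVar 0)) <|
    .seq (setIdxVar 9 (.lit 0)) <|
    .seq (.loop (.idxLt (idxVar 9) (idxVar 1)) <|
      .seq (.setReal 5 (idxVar 8) (idxVar 9) (.add (.read 5 (idxVar 8) (idxVar 9))
        (.mul (.read 6 (idxVar 8) (idxVar 9))
          (.div (oldEffPrice (idxVar 8) (idxVar 9)) (effPrice (idxVar 8) (idxVar 9)))))) (incr 9))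
    (incr 8)

/-- The whole algorithm. -/
def marketProg : Prog := .seq setUp <| .seq rescan <| .seq auction settle

/-! ### The invariant of the memory -/

/-- The memory `s` holds the market given by `n`, `m`, `ε`, `u`, `c`, `B`, a state of the auction
with `e j` raises of good `j`, correct tournaments, and for every good `j` a position such that no
holder before it has units of `j` bought at the previous price. -/
structure Good (n m : ℕ) (ε : ℝ) (u c : ℕ → ℕ → ℝ) (B : ℕ → ℝ) (e : ℕ → ℕ) (s : State) : Prop where
  goods_pos : 1 ≤ m
  eps_pos : 0 < ε
  util_nonneg : ∀ i j, 0 ≤ u i j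
  cost_nonneg : ∀ i j, 0 ≤ c i j
  n_eq : s.idx 0 0 0 = n
  m_eq : s.idx 1 0 0 = m
  eps_eq : s.real 0 0 0 = ε
  util_eq : s.real 2 = u
  cost_eq : s.real 3 = c
  auction : Auction n m ε u c B e (fun j => s.real 4 j 0) (s.real 5) (s.real 6)
    (fun i => s.real 1 i 0)
  tree : ∀ i < n, Tournament m (fun j => u i j / (s.real 4 j 0 + c i j)) (s.idx 5 i) 0
  pos_le : ∀ j < m, s.idx 4 j 0 ≤ n + 1
  pos_spec : ∀ j < m, ∀ k < s.idx 4 j 0, s.real 6 k j = 0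

/-- The favourite good of buyer `b`. -/
def State.fav (s : State) (b : ℕ) : ℕ := s.idx 5 b 1

/-- The holder from whom buyer `b` takes the favourite good. -/
def State.next (s : State) (b : ℕ) : ℕ := s.idx 4 (s.fav b) 0

/-- The effective price of the favourite good of buyer `b`. -/
noncomputable def State.cost (s : State) (b : ℕ) : ℝ := s.real 4 (s.fav b) 0 + s.real 3 b (s.fav b)

/-- What buyer `b` can take from the holder. -/
noncomputable def State.stock (s : State) (b : ℕ) : ℝ := s.real 6 (s.next b) (s.fav b)

/-- The refund of the holder per unit of money that buyer `b` spends. -/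
noncomputable def State.gain (s : State) (b : ℕ) : ℝ :=
  (s.real 4 (s.fav b) 0 / (1 + s.real 0 0 0) + s.real 3 (s.next b) (s.fav b)) / s.cost b

/-- The current buyer's favourite good and its holder have been located. -/
structure Located (s : State) (b : ℕ) : Prop where
  buyer : s.idx 2 0 0 = b
  good : s.idx 6 0 0 = s.fav b
  holder : s.idx 7 0 0 = s.next b

section

variable {n m : ℕ} {ε : ℝ} {u c : ℕ → ℕ → ℝ} {B : ℕ → ℝ} {e : ℕ → ℕ} {s s' : State} {b : ℕ}

theorem Good.congr (H : Good n m ε u c B e s) (hi : ∀ a ∈ [0, 1, 4, 5], s'.idx a = s.idx a)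
    (hr : ∀ a ∈ [0, 1, 2, 3, 4, 5, 6], s'.real a = s.real a) : Good n m ε u c B e s' := by
  have h0 := hi 0 (by simp)
  have h1 := hi 1 (by simp)
  have h4 := hi 4 (by simp)
  have h5 := hi 5 (by simp)
  have r0 := hr 0 (by simp)
  have r1 := hr 1 (by simp)
  have r2 := hr 2 (by simp)
  have r3 := hr 3 (by simp)
  have r4 := hr 4 (by simp)
  have r5 := hr 5 (by simp)
  have r6 := hr 6 (by simp)
  exact ⟨H.goods_pos, H.eps_pos, H.util_nonneg, H.cost_nonneg, h0 ▸ H.n_eq, h1 ▸ H.m_eq,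
    r0 ▸ H.eps_eq, r2 ▸ H.util_eq, r3 ▸ H.cost_eq, by rw [r4, r5, r6, r1]; exact H.auction,
    by rw [r4, h5]; exact H.tree, by rw [h4]; exact H.pos_le, by rw [h4, r6]; exact H.pos_spec⟩

theorem Good.fav_lt (H : Good n m ε u c B e s) (hb : b < n) : s.fav b < m :=
  (H.tree b hb).root_lt H.goods_pos

theorem Good.next_le (H : Good n m ε u c B e s) (hb : b < n) : s.next b ≤ n + 1 :=
  H.pos_le _ (H.fav_lt hb)

theorem Good.cost_pos (H : Good n m ε u c B e s) (hb : b < n) : 0 < s.cost b := by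
  refine add_pos_of_pos_of_nonneg (H.auction.price_pos H.eps_pos (H.fav_lt hb)) ?_
  rw [H.cost_eq]
  exact H.cost_nonneg _ _

theorem Good.gain_pos (H : Good n m ε u c B e s) (hb : b < n) : 0 < s.gain b := by
  refine div_pos (add_pos_of_pos_of_nonneg (div_pos (H.auction.price_pos H.eps_pos (H.fav_lt hb))
    ?_) ?_) (H.cost_pos hb)
  · rw [H.eps_eq]
    linarith [H.eps_pos]
  · rw [H.cost_eq]
    exact H.cost_nonneg _ _

theorem Good.best (H : Good n m ε u c B e s) (hb : b < n) {j : ℕ} (hj : j < m) :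
    u b j * (s.real 4 (s.fav b) 0 + c b (s.fav b)) ≤
      u b (s.fav b) * (s.real 4 j 0 + c b j) := by
  exact (div_le_div_iff₀ (add_pos_of_pos_of_nonneg (H.auction.price_pos H.eps_pos hj)
    (H.cost_nonneg _ _)) (add_pos_of_pos_of_nonneg (H.auction.price_pos H.eps_pos (H.fav_lt hb))
    (H.cost_nonneg _ _))).1 ((H.tree b hb).le_root hj)

theorem State.next_congr (hi : ∀ a ∈ [4, 5], s'.idx a = s.idx a) : s'.next = s.next := by
  funext b
  simp [State.next, State.fav, hi]

theorem State.fav_congr (hi : s'.idx 5 = s.idx 5) : s'.fav = s.fav := by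
  funext b
  simp [State.fav, hi]

theorem State.cost_congr (hi : s'.idx 5 = s.idx 5) (h3 : s'.real 3 = s.real 3)
    (h4 : s'.real 4 = s.real 4) : s'.cost = s.cost := by
  funext b
  simp [State.cost, State.fav, hi, h3, h4]

theorem State.gain_congr (hi : ∀ a ∈ [4, 5], s'.idx a = s.idx a)
    (hr : ∀ a ∈ [0, 3, 4], s'.real a = s.real a) : s'.gain = s.gain := by
  funext b
  simp [State.gain, State.cost, State.next, State.fav, hi, hr]

/-! ### Trading -/

theorem locate_spec (hb : s.idx 2 0 0 = b) :
    Total locate (fun t s' => t ≤ 20 ∧ s'.real = s.real ∧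
      (∀ a, a ∉ [6, 7] → s'.idx a = s.idx a) ∧ Located s' b) s := by
  subst hb
  simp only [locate, total_seq, total_setIdx, IdxExpr.eval, IdxExpr.cost, write_same]
  refine ⟨by norm_num, trivial, ?_, ?_⟩
  · intro a ha
    simp only [List.mem_cons, List.not_mem_nil, or_false, not_or] at ha
    rw [write_other _ ha.2, write_other _ ha.1]
  · exact ⟨by simp, by simp [State.fav], by simp [State.next, State.fav]⟩

theorem transfer_spec {b j k : ℕ} {φ q : ℝ} (hb : s.idx 2 0 0 = b) (hj : s.idx 6 0 0 = j)
    (hk : s.idx 7 0 0 = k) (hφ : s.real 7 0 0 = φ) (hq : q = φ / (s.real 4 j 0 + s.real 3 b j)) :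
    Total transfer (fun t s' => t ≤ 200 ∧ s'.idx = s.idx ∧
      (∀ a, a ∉ [1, 5, 6, 7, 9] → s'.real a = s.real a) ∧
      (∀ i l, s'.real 5 i l = s.real 5 i l + if i = b ∧ l = j then q else 0) ∧
      (∀ i l, s'.real 6 i l = s.real 6 i l - if i = k ∧ l = j then q else 0) ∧
      s'.real 7 0 0 = q * (s.real 4 j 0 / (1 + s.real 0 0 0) + s.real 3 k j) ∧
      (∀ i, s'.real 1 i 0 = s.real 1 i 0 - (if i = b then φ else 0) +
        if i = k then q * (s.real 4 j 0 / (1 + s.real 0 0 0) + s.real 3 k j) else 0)) s := by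
  subst hb hj hk hφ hq
  simp only [transfer, total_seq, total_setReal, IdxExpr.eval, RealExpr.eval, IdxExpr.cost,
    RealExpr.cost, write_same, ne_eq, Nat.reduceEqDiff, not_false_eq_true, write_other,
    OfNat.ofNat_ne_one, OfNat.zero_ne_ofNat, OfNat.one_ne_ofNat, and_self,
    and_true, if_true, true_and, Nat.cast_one]
  refine ⟨by norm_num, ?_, ?_, ?_, ?_⟩
  · intro a ha
    simp only [List.mem_cons, List.not_mem_nil, or_false, not_or] at ha
    simp [ha]
  · intro i l
    split_ifs with h
    · rw [h.1, h.2]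
    · rw [add_zero]
  · intro i l
    split_ifs with h
    · rw [h.1, h.2]
    · rw [sub_zero]
  · intro i
    by_cases h1 : i = s.idx 7 0 0
    · by_cases h2 : i = s.idx 2 0 0
      · simp [← h1, ← h2]
      · simp [← h1, h2]
    · by_cases h2 : i = s.idx 2 0 0
      · simp [h1, ← h2]
      · simp [h1, h2]

/-- A transfer of at most the capacity keeps the invariant. -/
theorem Good.transfer (H : Good n m ε u c B e s) (hL : Located s b) (hb : b < n)
    (hk : s.next b ≤ n) {φ : ℝ} (hφ : s.real 7 0 0 = φ) (h0 : 0 ≤ φ)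
    (hle : φ ≤ s.cost b * s.stock b) :
    Total transfer (fun t s' => t ≤ 200 ∧ Good n m ε u c B e s' ∧ s'.idx = s.idx ∧
      (∀ a, a ∉ [1, 5, 6, 7, 9] → s'.real a = s.real a) ∧
      (∀ i l, s'.real 6 i l =
        s.real 6 i l - if i = s.next b ∧ l = s.fav b then φ / s.cost b else 0) ∧
      s'.real 7 0 0 = φ * s.gain b ∧
      (∀ i, s'.real 1 i 0 = s.real 1 i 0 - (if i = b then φ else 0) +
        if i = s.next b then φ * s.gain b else 0)) s := by
  have hg : φ / s.cost b *
      (s.real 4 (s.fav b) 0 / (1 + s.real 0 0 0) + s.real 3 (s.next b) (s.fav b)) =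
      φ * s.gain b := by
    rw [State.gain]
    ring
  refine (transfer_spec hL.buyer hL.good hL.holder hφ (q := φ / s.cost b) rfl).mono ?_
  rintro t s' ⟨ht, hi, hr, hy, hh, h7, h1⟩
  rw [hg] at h7
  simp only [hg] at h1
  refine ⟨ht, ?_, hi, hr, hh, h7, h1⟩
  have r0 := hr 0 (by simp)
  have r2 := hr 2 (by simp)
  have r3 := hr 3 (by simp)
  have r4 := hr 4 (by simp)
  have hA := H.auction.transfer H.eps_pos H.cost_nonneg hb (H.fav_lt hb) hk h0
    (by simpa only [State.cost, State.stock, H.cost_eq] using hle)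
    (q := φ / s.cost b) (by rw [State.cost, H.cost_eq]) (fun j hj => H.best hb hj) hy hh
    (r' := fun i => s'.real 1 i 0) (by
      intro i _
      rw [h1, ← hg, H.eps_eq, H.cost_eq])
  refine ⟨H.goods_pos, H.eps_pos, H.util_nonneg, H.cost_nonneg, hi ▸ H.n_eq, hi ▸ H.m_eq,
    r0 ▸ H.eps_eq, r2 ▸ H.util_eq, r3 ▸ H.cost_eq, by rw [r4]; exact hA,
    by rw [r4, hi]; exact H.tree, by rw [hi]; exact H.pos_le, ?_⟩
  rw [hi]
  intro j hj k hk'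
  have h0' := H.pos_spec j hj k hk'
  rw [hh, if_neg, h0', sub_zero]
  rintro ⟨rfl, rfl⟩
  exact absurd hk' (lt_irrefl _)

end

/-! ### Holdings, money, and single trades -/

/-- The buyers with unspent money. -/
noncomputable def moneyed (n : ℕ) (r : ℕ → ℝ) : Finset ℕ := {i ∈ Finset.range n | 0 < r i}

/-- The pairs of a holder, possibly the seller, and a good that the holder has from its previous
price. -/
noncomputable def held (n m : ℕ) (h : ℕ → ℕ → ℝ) : Finset (ℕ × ℕ) :=
  {x ∈ Finset.range (n + 1) ×ˢ Finset.range m | 0 < h x.1 x.2}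

section

variable {n m : ℕ} {ε : ℝ} {u c : ℕ → ℕ → ℝ} {B : ℕ → ℝ} {e : ℕ → ℕ} {s s' : State} {b : ℕ}

theorem mem_moneyed {r : ℕ → ℝ} {i : ℕ} : i ∈ moneyed n r ↔ i < n ∧ 0 < r i := by
  simp [moneyed]

theorem mem_held {h : ℕ → ℕ → ℝ} {x : ℕ × ℕ} :
    x ∈ held n m h ↔ (x.1 ≤ n ∧ x.2 < m) ∧ 0 < h x.1 x.2 := by
  simp [held]

theorem held_subset {h h' : ℕ → ℕ → ℝ} (hle : ∀ i l, h' i l ≤ h i l) :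
    held n m h' ⊆ held n m h := by
  intro x hx
  rw [mem_held] at hx ⊢
  exact ⟨hx.1, hx.2.trans_le (hle _ _)⟩

theorem held_card_lt {h h' : ℕ → ℕ → ℝ} (hle : ∀ i l, h' i l ≤ h i l) {k j : ℕ} (hk : k ≤ n)
    (hj : j < m) (h0 : 0 < h k j) (h1 : h' k j = 0) :
    (held n m h').card < (held n m h).card := by
  refine Finset.card_lt_card (Finset.ssubset_iff_subset_ne.2 ⟨held_subset hle, fun he => ?_⟩)
  have : (k, j) ∈ held n m h := mem_held.2 ⟨⟨hk, hj⟩, h0⟩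
  rw [← he, mem_held] at this
  exact absurd this.2 (by simp [h1])

/-- A transfer after storing its amount `φ` in scalar `7`. -/
theorem Good.spend (H : Good n m ε u c B e s) (hL : Located s b) (hb : b < n)
    (hk : s.next b ≤ n) {φ : ℝ} (h0 : 0 ≤ φ) (hle : φ ≤ s.cost b * s.stock b) :
    Total RealRAM.transfer (fun t s' => t ≤ 200 ∧ Good n m ε u c B e s' ∧ s'.idx = s.idx ∧
      (∀ i l, s'.real 6 i l =
        s.real 6 i l - if i = s.next b ∧ l = s.fav b then φ / s.cost b else 0) ∧
      (∀ i, s'.real 1 i 0 = s.real 1 i 0 - (if i = b then φ else 0) +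
        if i = s.next b then φ * s.gain b else 0)) ⟨s.idx, write s.real 7 0 0 φ⟩ := by
  have hset : Good n m ε u c B e ⟨s.idx, write s.real 7 0 0 φ⟩ := H.congr (by simp) (by simp)
  refine (hset.transfer (b := b) ⟨hL.buyer, hL.good, hL.holder⟩ hb hk (φ := φ) (by simp) h0
    (by simpa [State.cost, State.stock, State.next, State.fav] using hle)).mono ?_
  rintro t s' ⟨ht, hG, hi, -, hh, -, h1⟩
  have hn : State.next ⟨s.idx, write s.real 7 0 0 φ⟩ = s.next := rfl
  have hf : State.fav ⟨s.idx, write s.real 7 0 0 φ⟩ = s.fav := rfl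
  have hcst : State.cost ⟨s.idx, write s.real 7 0 0 φ⟩ = s.cost :=
    State.cost_congr rfl (by simp) (by simp)
  have hgn : State.gain ⟨s.idx, write s.real 7 0 0 φ⟩ = s.gain :=
    State.gain_congr (by simp) (by simp)
  rw [hn, hf, hcst] at hh
  rw [hn, hgn] at h1
  simp only [ne_eq, Nat.reduceEqDiff, not_false_eq_true, write_other, OfNat.one_ne_ofNat] at hh h1
  exact ⟨ht, hG, hi, hh, h1⟩

/-- A trade either uses up a holding, which may give one more buyer money, or it moves the money of
the current buyer on to the holder, and then no holding disappears. -/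
theorem Good.trade (H : Good n m ε u c B e s) (hL : Located s b) (hb : b < n)
    (hk : s.next b ≤ n) (hstock : 0 < s.stock b) (hr : ∀ i < n, 0 ≤ s.real 1 i 0)
    (hrb : 0 < s.real 1 b 0) :
    Total trade (fun t s' => t ≤ 300 ∧ Good n m ε u c B e s' ∧
      (∀ a, a ∉ [2, 3] → s'.idx a = s.idx a) ∧ (∀ i < n, 0 ≤ s'.real 1 i 0) ∧
      ((s'.idx 2 0 0 = s.next b ∧ s'.idx 3 0 0 = s.idx 3 0 0 + 1 ∧
        (∀ i l, 0 < s.real 6 i l → 0 < s'.real 6 i l) ∧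
        (held n m (s'.real 6)).card ≤ (held n m (s.real 6)).card ∧
        (s.next b < n → 0 < s'.real 1 (s.next b) 0 ∧
          (moneyed n fun i => s'.real 1 i 0).card ≤ (moneyed n fun i => s.real 1 i 0).card) ∧
        (s.next b = n →
          (moneyed n fun i => s'.real 1 i 0).card < (moneyed n fun i => s.real 1 i 0).card)) ∨
       (s'.idx 2 0 0 = b ∧ s'.idx 3 0 0 = 0 ∧
        (held n m (s'.real 6)).card < (held n m (s.real 6)).card ∧
        (moneyed n fun i => s'.real 1 i 0).card ≤
          (moneyed n fun i => s.real 1 i 0).card + 1))) s := by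
  have hcost := H.cost_pos hb
  have hgain := H.gain_pos hb
  have hcap : (RealExpr.mul (effPrice (idxVar 2) (idxVar 6))
      (.read 6 (idxVar 7) (idxVar 6))).eval s = s.cost b * s.stock b := by
    simp [hL.buyer, hL.good, hL.holder, State.cost, State.stock]
  have hrd : (RealExpr.read 1 (idxVar 2) (.lit 0)).eval s = s.real 1 b 0 := by
    simp [hL.buyer]
  rw [RealRAM.trade, total_ite]
  refine ⟨fun hlt => ?_, fun hlt => ?_⟩
  · have hlt : s.real 1 b 0 < s.cost b * s.stock b := by
      have := hlt
      rwa [Test.Holds, hcap, hrd] at this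
    rw [total_seq, total_setReal, hrd, total_seq]
    refine (H.spend hL hb hk hrb.le hlt.le).mono ?_
    rintro t s' ⟨ht, hG, hi, hh, h1⟩
    have hrefund : 0 < s.real 1 b 0 * s.gain b := mul_pos hrb hgain
    have hr' : ∀ i < n, 0 ≤ s'.real 1 i 0 := by
      intro i hi'
      rw [h1]
      have := hr i hi'
      by_cases hib : i = b
      · subst hib
        simp only [if_true]
        split_ifs <;> linarith
      · simp only [hib, if_false]
        split_ifs <;> linarith
    have hpos : ∀ i < n, i ≠ s.next b → 0 < s'.real 1 i 0 → i ≠ b ∧ 0 < s.real 1 i 0 := by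
      intro i _ hik h0
      rw [h1, if_neg hik] at h0
      by_cases hib : i = b
      · subst hib
        simp at h0
      · simp only [hib, if_false] at h0
        exact ⟨hib, by linarith⟩
    have hbm : b ∈ moneyed n fun i => s.real 1 i 0 := mem_moneyed.2 ⟨hb, hrb⟩
    have hle : ∀ i l, s'.real 6 i l ≤ s.real 6 i l := by
      intro i l
      have : 0 ≤ s.real 1 b 0 / s.cost b := (div_pos hrb hcost).le
      rw [hh]
      split_ifs <;> linarith
    simp only [total_seq, total_setIdx, IdxExpr.eval, IdxExpr.cost, Test.cost, RealExpr.cost]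
    refine ⟨by omega, hG.congr (by simp) (by simp), ?_, hr', Or.inl ⟨?_, ?_, ?_,
      Finset.card_le_card (held_subset hle), ?_, ?_⟩⟩
    · intro a ha
      simp only [List.mem_cons, List.not_mem_nil, or_false, not_or] at ha
      simp [ha, hi]
    · simp [hi, hL.holder]
    · simp [hi]
    · intro i l h0
      rw [hh]
      split_ifs with hil
      · rw [hil.1, hil.2, sub_pos, div_lt_iff₀ hcost, mul_comm]
        exact hlt
      · linarith
    · intro hkn
      constructor
      · show 0 < s'.real 1 (s.next b) 0
        rw [h1, if_pos rfl]
        have := hr _ hkn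
        split_ifs with hkb
        · rw [hkb]
          linarith
        · linarith
      · refine (Finset.card_le_card (t := insert (s.next b)
          ((moneyed n fun i => s.real 1 i 0).erase b)) ?_).trans ?_
        · intro i hi'
          rw [mem_moneyed] at hi'
          by_cases hik : i = s.next b
          · simp [hik]
          · have := hpos i hi'.1 hik hi'.2
            exact Finset.mem_insert_of_mem
              (Finset.mem_erase.2 ⟨this.1, mem_moneyed.2 ⟨hi'.1, this.2⟩⟩)
        · refine (Finset.card_insert_le _ _).trans ?_
          rw [Finset.card_erase_of_mem hbm]
          have := Finset.card_pos.2 ⟨b, hbm⟩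
          omega
    · intro hkn
      refine Finset.card_lt_card ((Finset.ssubset_iff_of_subset ?_).2 ⟨b, hbm, ?_⟩)
      · intro i hi'
        rw [mem_moneyed] at hi' ⊢
        exact ⟨hi'.1, (hpos i hi'.1 (by omega) hi'.2).2⟩
      · intro hbm'
        rw [mem_moneyed] at hbm'
        exact (hpos b hb (by omega) hbm'.2).1 rfl
  · have hlt : s.cost b * s.stock b ≤ s.real 1 b 0 := by
      have := hlt
      rwa [Test.Holds, hcap, hrd, not_lt] at this
    have hc0 : 0 < s.cost b * s.stock b := mul_pos hcost hstock
    rw [total_seq, total_setReal, hcap, total_seq]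
    refine (H.spend hL hb hk hc0.le le_rfl).mono ?_
    rintro t s' ⟨ht, hG, hi, hh, h1⟩
    rw [mul_div_cancel_left₀ _ hcost.ne'] at hh
    have hrefund : 0 < s.cost b * s.stock b * s.gain b := mul_pos hc0 hgain
    have hr' : ∀ i < n, 0 ≤ s'.real 1 i 0 := by
      intro i hi'
      rw [h1]
      have := hr i hi'
      by_cases hib : i = b
      · subst hib
        simp only [if_true]
        split_ifs <;> linarith
      · simp only [hib, if_false]
        split_ifs <;> linarith
    have hle : ∀ i l, s'.real 6 i l ≤ s.real 6 i l := by
      intro i l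
      rw [hh]
      split_ifs <;> linarith
    simp only [total_setIdx, IdxExpr.eval, IdxExpr.cost, Test.cost, RealExpr.cost]
    refine ⟨by omega, hG.congr (by simp) (by simp), ?_, hr', Or.inr ⟨?_, ?_, ?_, ?_⟩⟩
    · intro a ha
      simp only [List.mem_cons, List.not_mem_nil, or_false, not_or] at ha
      simp [ha, hi]
    · simp [hi, hL.buyer]
    · simp
    · refine held_card_lt hle hk (H.fav_lt hb) hstock ?_
      rw [hh, if_pos ⟨rfl, rfl⟩, State.stock, sub_self]
    · refine (Finset.card_le_card (t := insert (s.next b) (moneyed n fun i => s.real 1 i 0))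
        ?_).trans (Finset.card_insert_le _ _)
      intro i hi'
      rw [mem_moneyed] at hi'
      by_cases hik : i = s.next b
      · simp [hik]
      · refine Finset.mem_insert_of_mem (mem_moneyed.2 ⟨hi'.1, ?_⟩)
        have h2 : 0 < s'.real 1 i 0 := hi'.2
        rw [h1, if_neg hik] at h2
        split_ifs at h2 <;> linarith

end

/-! ### Trading around a cycle -/

section

variable {n m : ℕ} {ε : ℝ} {u c : ℕ → ℕ → ℝ} {B : ℕ → ℝ} {e : ℕ → ℕ} {s s' : State} {b : ℕ}

/-- A loop over the vertices of a cycle of length `d`, the walk around which starts in `b`. -/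
theorem total_around {P : Prog} (I : ℕ → State → Prop) (T : ℕ) {F : ℕ → ℕ} {d : ℕ} (hd : 0 < d)
    (hret : F^[d] b = b) (hne : ∀ i, 0 < i → i < d → F^[i] b ≠ b)
    (hI : ∀ i s, I i s → s.idx 2 0 0 = F^[i] b ∧ s.idx 10 0 0 = b)
    (step : ∀ i s, i < d → I i s → Total P (fun t s' => t ≤ T ∧ I (i + 1) s') s)
    (h0 : I 0 s) :
    Total (around P) (fun t s' => t ≤ d * (T + 20) ∧ I d s') s := by
  rw [around, total_seq]
  refine (step 0 s hd h0).mono ?_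
  rintro t s₁ ⟨ht, h1⟩
  refine (total_loop_count (fun i s => (1 ≤ i ∧ i ≤ d) ∧ I i s) T d ?_ ?_ (i := 1) hd
    ⟨⟨le_rfl, hd⟩, h1⟩).mono ?_
  · rintro i s ⟨hi, hs⟩
    obtain ⟨h2, h10⟩ := hI i s hs
    have hb : away.Holds s ↔ F^[i] b ≠ b := by
      simp only [Test.Holds, IdxExpr.eval, h2, h10]
      omega
    rw [hb]
    constructor
    · intro h
      rcases hi.2.lt_or_eq with h' | h'
      · exact h'
      · exact absurd (h' ▸ hret) h
    · exact hne i hi.1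
  · rintro i s hi ⟨_, hs⟩
    exact (step i s hi hs).mono fun t s' h => ⟨h.1, ⟨by omega, hi⟩, h.2⟩
  · rintro t' s' ⟨ht', _, hs'⟩
    refine ⟨?_, hs'⟩
    obtain ⟨k, rfl⟩ : ∃ k, d = k + 1 := ⟨d - 1, by omega⟩
    have hc : away.cost = 18 := rfl
    rw [hc, Nat.add_sub_cancel] at ht'
    rw [add_mul]
    have : k * (T + 1 + 18) ≤ k * (T + 20) := Nat.mul_le_mul_left _ (by omega)
    omega

theorem probe_spec (hb : s.idx 2 0 0 = b) :
    Total probe (fun t s' => t ≤ 200 ∧ (∀ a, a ∉ [2, 6, 7] → s'.idx a = s.idx a) ∧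
      (∀ a, a ∉ [7, 8, 9] → s'.real a = s.real a) ∧ s'.idx 2 0 0 = s.next b ∧
      s'.real 7 0 0 = s.real 7 0 0 * s.gain b ∧
      s'.real 8 0 0 = if s.stock b < s.real 8 0 0 * (s.real 7 0 0 / s.cost b) then
        s.stock b / (s.real 7 0 0 / s.cost b) else s.real 8 0 0) s := by
  rw [probe, total_seq]
  refine (locate_spec hb).mono ?_
  rintro t s₁ ⟨ht, hr, hi, hL⟩
  have hn : s₁.next = s.next := State.next_congr fun a ha => hi a (by
    simp only [List.mem_cons, List.not_mem_nil, or_false] at ha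
    rcases ha with rfl | rfl <;> simp)
  have hf : s₁.fav = s.fav := State.fav_congr (hi 5 (by simp))
  have h2 := hL.buyer
  have h6 := hL.good
  have h7 := hL.holder
  rw [hf] at h6
  rw [hn] at h7
  have hcost : s.real 4 (s.fav b) 0 + s.real 3 b (s.fav b) = s.cost b := rfl
  have hstock : s.real 6 (s.next b) (s.fav b) = s.stock b := rfl
  have hgain : s.real 7 0 0 / s.cost b *
      (s.real 4 (s.fav b) 0 / (1 + s.real 0 0 0) + s.real 3 (s.next b) (s.fav b)) =
      s.real 7 0 0 * s.gain b := by
    rw [State.gain]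
    ring
  have hframe : ∀ a, a ∉ [2, 6, 7] → s₁.idx a = s.idx a := fun a ha => hi a (by
    simp only [List.mem_cons, List.not_mem_nil, or_false, not_or] at ha ⊢
    exact ha.2)
  rcases lt_or_ge (s.stock b) (s.real 8 0 0 * (s.real 7 0 0 / s.cost b)) with hlt | hlt
  · simp [h2, h6, h7, hr, hcost, hstock, hlt, hgain]
    refine ⟨by omega, fun a a2 a6 a7 => ?_, fun a a7 a8 a9 => ?_⟩
    · rw [write_other _ a2, hframe a (by simp [a2, a6, a7])]
    · simp [a7, a8, a9]
  · simp [h2, h6, h7, hr, hcost, hstock, hlt, not_lt.2 hlt, hgain]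
    refine ⟨by omega, fun a a2 a6 a7 => ?_, fun a a7 _ a9 => ?_⟩
    · rw [write_other _ a2, hframe a (by simp [a2, a6, a7])]
    · simp [a7, a9]

/-- The money that arrives after `i` steps of the walk from `b`, per unit of money spent by `b`. -/
noncomputable def State.factor (s : State) (b i : ℕ) : ℝ :=
  ∏ l ∈ Finset.range i, s.gain (s.next^[l] b)

theorem State.factor_succ (s : State) (b i : ℕ) :
    s.factor b (i + 1) = s.factor b i * s.gain (s.next^[i] b) :=
  Finset.prod_range_succ _ _

theorem Good.factor_pos (H : Good n m ε u c B e s) (hw : ∀ i, s.next^[i] b < n) (i : ℕ) :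
    0 < s.factor b i :=
  Finset.prod_pos fun l _ => H.gain_pos (hw l)

/-- The walk without trades around a cycle finds the gain of the cycle, and the amount `θ` whose
circulation uses up a holding, but none more than once. -/
theorem Good.probe_around (H : Good n m ε u c B e s) {d : ℕ} (hd : 0 < d)
    (hret : s.next^[d] b = b) (hne : ∀ i, 0 < i → i < d → s.next^[i] b ≠ b)
    (hw : ∀ i, s.next^[i] b < n ∧ 0 < s.stock (s.next^[i] b))
    (h2 : s.idx 2 0 0 = b) (h10 : s.idx 10 0 0 = b) (h7 : s.real 7 0 0 = 1)
    (h8 : s.real 8 0 0 = s.cost b * s.stock b) :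
    Total (around probe) (fun t s' => t ≤ d * 220 ∧
      (∀ a, a ∉ [2, 6, 7] → s'.idx a = s.idx a) ∧
      (∀ a, a ∉ [7, 8, 9] → s'.real a = s.real a) ∧ s'.idx 2 0 0 = b ∧
      s'.real 7 0 0 = s.factor b d ∧ 0 < s'.real 8 0 0 ∧
      (∀ l < d, s'.real 8 0 0 * s.factor b l ≤
        s.cost (s.next^[l] b) * s.stock (s.next^[l] b)) ∧
      ∃ l < d, s'.real 8 0 0 * s.factor b l =
        s.cost (s.next^[l] b) * s.stock (s.next^[l] b)) s := by
  refine (total_around (fun i s' => (∀ a, a ∉ [2, 6, 7] → s'.idx a = s.idx a) ∧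
      (∀ a, a ∉ [7, 8, 9] → s'.real a = s.real a) ∧ s'.idx 2 0 0 = s.next^[i] b ∧
      s'.real 7 0 0 = s.factor b i ∧ 0 < s'.real 8 0 0 ∧
      (∀ l < i, s'.real 8 0 0 * s.factor b l ≤
        s.cost (s.next^[l] b) * s.stock (s.next^[l] b)) ∧
      ∃ l, (l < i ∨ l = 0) ∧ s'.real 8 0 0 * s.factor b l =
        s.cost (s.next^[l] b) * s.stock (s.next^[l] b)) 200 hd hret hne ?_ ?_ ?_).mono ?_
  · rintro i s' ⟨hi, -, h2', -⟩
    exact ⟨h2', by rw [hi 10 (by simp), h10]⟩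
  · rintro i s₁ hid ⟨hi, hr, h2', h7', h8', hle, l₀, hl₀, heq⟩
    refine (probe_spec h2').mono ?_
    have hi' : ∀ a ∈ [4, 5], s₁.idx a = s.idx a := by
      intro a ha
      simp only [List.mem_cons, List.not_mem_nil, or_false] at ha
      rcases ha with rfl | rfl <;> exact hi _ (by simp)
    have hn : s₁.next = s.next := State.next_congr hi'
    have hf : s₁.fav = s.fav := State.fav_congr (hi 5 (by simp))
    have hc : s₁.cost = s.cost :=
      State.cost_congr (hi 5 (by simp)) (hr 3 (by simp)) (hr 4 (by simp))
    have hg : s₁.gain = s.gain := State.gain_congr hi' (by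
      intro a ha
      simp only [List.mem_cons, List.not_mem_nil, or_false] at ha
      rcases ha with rfl | rfl | rfl <;> exact hr _ (by simp))
    have hst : s₁.stock = s.stock := by
      funext x
      rw [State.stock, State.stock, hn, hf, hr 6 (by simp)]
    rw [hn, hc, hg, hst, h7']
    rintro t s' ⟨ht, hi₁, hr₁, h2₁, h7₁, h8₁⟩
    have hcost := H.cost_pos (hw i).1
    have hfac := H.factor_pos (fun i => (hw i).1) i
    have hstock := (hw i).2
    have hq : 0 < s.factor b i / s.cost (s.next^[i] b) := div_pos hfac hcost
    refine ⟨ht, fun a ha => (hi₁ a ha).trans (hi a ha), fun a ha => (hr₁ a ha).trans (hr a ha),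
      ?_, ?_, ?_⟩
    · rw [h2₁, Function.iterate_succ_apply']
    · rw [h7₁, State.factor_succ]
    · rw [h8₁]
      split_ifs with hlt
      · have hnew : s.stock (s.next^[i] b) / (s.factor b i / s.cost (s.next^[i] b)) *
            s.factor b i = s.cost (s.next^[i] b) * s.stock (s.next^[i] b) := by
          field_simp
        have hless : s.stock (s.next^[i] b) / (s.factor b i / s.cost (s.next^[i] b)) ≤
            s₁.real 8 0 0 := by
          rw [div_le_iff₀ hq]
          exact hlt.le
        refine ⟨div_pos hstock hq, fun l hl => ?_, i, Or.inl (by omega), hnew⟩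
        rcases Nat.lt_succ_iff_lt_or_eq.1 hl with h | h
        · exact (mul_le_mul_of_nonneg_right hless
            (H.factor_pos (fun i => (hw i).1) l).le).trans (hle l h)
        · rw [h, hnew]
      · refine ⟨h8', fun l hl => ?_, l₀, hl₀.imp_left (by omega), heq⟩
        rcases Nat.lt_succ_iff_lt_or_eq.1 hl with h | h
        · exact hle l h
        · rw [not_lt, ← mul_div_assoc, div_le_iff₀ hcost] at hlt
          rw [h]
          linarith
  · refine ⟨fun _ _ => rfl, fun _ _ => rfl, h2, by rw [h7]; simp [State.factor], ?_, by simp,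
      0, Or.inr rfl, by rw [h8]; simp [State.factor]⟩
    rw [h8]
    exact mul_pos (H.cost_pos (hw 0).1) (hw 0).2
  · rintro t s' ⟨ht, hi, hr, h2', h7', h8', hle, l, hl, heq⟩
    exact ⟨ht, hi, hr, by rw [h2', hret], h7', h8', hle, l, by omega, heq⟩

/-- Trading around a cycle with the amount `φ` at the start. The holdings that `φ` matches are
used up, and only the money of the buyer at the start changes. -/
theorem Good.push_around (H : Good n m ε u c B e s) {d : ℕ} (hd : 0 < d)
    (hret : s.next^[d] b = b) (hne : ∀ i, 0 < i → i < d → s.next^[i] b ≠ b)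
    (hinj : Set.InjOn (fun i => s.next^[i] b) (Set.Iio d))
    (hw : ∀ i, s.next^[i] b < n)
    (h2 : s.idx 2 0 0 = b) (h10 : s.idx 10 0 0 = b) {φ : ℝ} (h7 : s.real 7 0 0 = φ) (hφ : 0 ≤ φ)
    (hle : ∀ l < d, φ * s.factor b l ≤ s.cost (s.next^[l] b) * s.stock (s.next^[l] b)) :
    Total (around push) (fun t s' => t ≤ d * 270 ∧ Good n m ε u c B e s' ∧
      (∀ a, a ∉ [2, 6, 7] → s'.idx a = s.idx a) ∧ s'.idx 2 0 0 = b ∧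
      (∀ i, s'.real 1 i 0 =
        s.real 1 i 0 - (if i = b then φ else 0) + if i = b then φ * s.factor b d else 0) ∧
      (∀ i l, s'.real 6 i l ≤ s.real 6 i l) ∧
      ∀ l < d, φ * s.factor b l = s.cost (s.next^[l] b) * s.stock (s.next^[l] b) →
        s'.real 6 (s.next^[l + 1] b) (s.fav (s.next^[l] b)) = 0) s := by
  have hwalk : ∀ i l, i < l → l < d → s.next^[l + 1] b ≠ s.next^[i + 1] b := by
    intro i l hil hld heq
    rcases (show l + 1 ≤ d from hld).lt_or_eq with h | h
    · have := hinj (Set.mem_Iio.2 h) (Set.mem_Iio.2 (by omega : i + 1 < d)) heq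
      omega
    · rw [h, hret] at heq
      exact hne (i + 1) (by omega) (by omega) heq.symm
  refine (total_around (fun i s' => Good n m ε u c B e s' ∧
      (∀ a, a ∉ [2, 6, 7] → s'.idx a = s.idx a) ∧
      (∀ a, a ∉ [1, 5, 6, 7, 9] → s'.real a = s.real a) ∧ s'.idx 2 0 0 = s.next^[i] b ∧
      s'.real 7 0 0 = φ * s.factor b i ∧
      (∀ x, s'.real 1 x 0 = s.real 1 x 0 - (if x = b then φ else 0) +
        if x = s.next^[i] b then φ * s.factor b i else 0) ∧
      (∀ x l, s'.real 6 x l ≤ s.real 6 x l) ∧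
      (∀ l, i ≤ l → l < d → s'.real 6 (s.next^[l + 1] b) (s.fav (s.next^[l] b)) =
        s.stock (s.next^[l] b)) ∧
      ∀ l < i, φ * s.factor b l = s.cost (s.next^[l] b) * s.stock (s.next^[l] b) →
        s'.real 6 (s.next^[l + 1] b) (s.fav (s.next^[l] b)) = 0) 250 hd hret hne ?_ ?_ ?_).mono ?_
  · rintro i s' ⟨-, hi, -, h2', -⟩
    exact ⟨h2', by rw [hi 10 (by simp), h10]⟩
  · rintro i s₁ hid ⟨hG, hi, hr, h2', h7', h1', hmono, hrest, hdone⟩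
    have hi' : ∀ a ∈ [4, 5], s₁.idx a = s.idx a := by
      intro a ha
      simp only [List.mem_cons, List.not_mem_nil, or_false] at ha
      rcases ha with rfl | rfl <;> exact hi _ (by simp)
    rw [push, total_seq]
    refine (locate_spec h2').mono ?_
    rintro t₂ s₂ ⟨ht₂, hr₂, hi₂, hL⟩
    have hi₂' : ∀ a ∈ [4, 5], s₂.idx a = s₁.idx a := by
      intro a ha
      simp only [List.mem_cons, List.not_mem_nil, or_false] at ha
      rcases ha with rfl | rfl <;> exact hi₂ _ (by simp)
    have hG₂ : Good n m ε u c B e s₂ := hG.congr (by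
      intro a ha
      simp only [List.mem_cons, List.not_mem_nil, or_false] at ha
      rcases ha with rfl | rfl | rfl | rfl <;> exact hi₂ _ (by simp)) (by simp [hr₂])
    have hn : s₂.next = s.next := (State.next_congr hi₂').trans (State.next_congr hi')
    have hf : s₂.fav = s.fav :=
      (State.fav_congr (hi₂' 5 (by simp))).trans (State.fav_congr (hi' 5 (by simp)))
    have hc : s₂.cost = s.cost :=
      (State.cost_congr (hi₂' 5 (by simp)) (by rw [hr₂]) (by rw [hr₂])).trans
      (State.cost_congr (hi' 5 (by simp)) (hr 3 (by simp)) (hr 4 (by simp)))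
    have hg : s₂.gain = s.gain := (State.gain_congr hi₂' (by simp [hr₂])).trans
      (State.gain_congr hi' (by
        intro a ha
        simp only [List.mem_cons, List.not_mem_nil, or_false] at ha
        rcases ha with rfl | rfl | rfl <;> exact hr _ (by simp)))
    have hst : s₂.stock (s.next^[i] b) = s.stock (s.next^[i] b) := by
      have := hrest i le_rfl hid
      rw [Function.iterate_succ_apply'] at this
      rw [State.stock, hn, hf, hr₂, this]
    have hfac : 0 ≤ φ * s.factor b i := mul_nonneg hφ (H.factor_pos hw i).le
    have hcost := H.cost_pos (hw i)
    rw [total_seq]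
    refine (hG₂.transfer hL (hw i) (by
      rw [hn, ← Function.iterate_succ_apply' s.next]; exact (hw _).le) (φ := φ * s.factor b i)
      (by rw [hr₂, h7']) hfac (by rw [hc, hst]; exact hle i hid)).mono ?_
    rw [hn, hf, hc, hg, hr₂, ← Function.iterate_succ_apply' s.next i b]
    rintro t₃ s₃ ⟨ht₃, hG₃, hi₃, hr₃, hh₃, h7₃, h1₃⟩
    have hq : 0 ≤ φ * s.factor b i / s.cost (s.next^[i] b) := div_nonneg hfac hcost.le
    have hmono₃ : ∀ x l, s₃.real 6 x l ≤ s₁.real 6 x l := by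
      intro x l
      rw [hh₃]
      split_ifs <;> linarith
    simp only [total_setIdx, IdxExpr.eval, IdxExpr.cost]
    refine ⟨by omega, hG₃.congr (by simp) (by simp), ?_, ?_, ?_, ?_, ?_, ?_, ?_, ?_⟩
    · intro a ha
      have ha' := ha
      simp only [List.mem_cons, List.not_mem_nil, or_false, not_or] at ha'
      rw [write_other _ ha'.1, hi₃, hi₂ a (by simp [ha']), hi a ha]
    · intro a ha
      exact (hr₃ a ha).trans (hr a ha)
    · rw [write_same, if_pos ⟨rfl, rfl⟩, hi₃, hL.holder, hn, Function.iterate_succ_apply']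
    · rw [h7₃, State.factor_succ]
      ring
    · intro x
      rw [h1₃, h1', State.factor_succ, mul_assoc]
      ring
    · exact fun x l => (hmono₃ x l).trans (hmono x l)
    · intro l hil hld
      rw [← hrest l (by omega) hld]
      show s₃.real 6 _ _ = _
      rw [hh₃, if_neg, sub_zero]
      rintro ⟨h, -⟩
      exact hwalk i l hil hld h
    · intro l hl heq
      show s₃.real 6 _ _ = 0
      rcases Nat.lt_succ_iff_lt_or_eq.1 hl with h | h
      · have h0 := hdone l h heq
        refine le_antisymm (h0 ▸ hmono₃ _ _) ?_
        refine hG₃.auction.h_nonneg _ (hw _).le _ (H.fav_lt (hw l))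
      · subst h
        rw [hh₃, if_pos ⟨rfl, rfl⟩, hrest l le_rfl hid, heq, mul_div_cancel_left₀ _ hcost.ne',
          sub_self]
  · refine ⟨H, fun _ _ => rfl, fun _ _ => rfl, h2, by rw [h7]; simp [State.factor], ?_,
      fun _ _ => le_rfl, ?_, by simp⟩
    · intro x
      simp [State.factor]
    · intro l _ _
      rw [Function.iterate_succ_apply']
      rfl
  · rintro t s' ⟨ht, hG, hi, -, h2', -, h1', hmono, -, hdone⟩
    exact ⟨ht, hG, hi, by rw [h2', hret], by simpa only [hret] using h1', hmono, hdone⟩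

/-- The effect of circulating money from buyer `b`: a holding or the money of `b` is used up, and
nobody obtains money who had none. -/
def Circulated (n m : ℕ) (ε : ℝ) (u c : ℕ → ℕ → ℝ) (B : ℕ → ℝ) (e : ℕ → ℕ) (b : ℕ)
    (s s' : State) : Prop :=
  Good n m ε u c B e s' ∧
    (∀ a, a ∉ [2, 3, 6, 7, 10] → s'.idx a = s.idx a) ∧ (∀ i < n, 0 ≤ s'.real 1 i 0) ∧
    s'.idx 2 0 0 = b ∧ s'.idx 3 0 0 = 0 ∧
    (held n m (s'.real 6)).card ≤ (held n m (s.real 6)).card ∧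
    (moneyed n fun i => s'.real 1 i 0).card ≤ (moneyed n fun i => s.real 1 i 0).card ∧
    ((held n m (s'.real 6)).card < (held n m (s.real 6)).card ∨
      (moneyed n fun i => s'.real 1 i 0).card < (moneyed n fun i => s.real 1 i 0).card)

theorem Good.circulate (H : Good n m ε u c B e s) (hL : Located s b) (hb : b < n) {d : ℕ}
    (hd : 0 < d) (hret : s.next^[d] b = b) (hne : ∀ i, 0 < i → i < d → s.next^[i] b ≠ b)
    (hinj : Set.InjOn (fun i => s.next^[i] b) (Set.Iio d))
    (hw : ∀ i, s.next^[i] b < n ∧ 0 < s.stock (s.next^[i] b))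
    (hr : ∀ i < n, 0 ≤ s.real 1 i 0) (hrb : 0 < s.real 1 b 0) :
    Total circulate (fun t s' => t ≤ d * 490 + 300 ∧ Circulated n m ε u c B e b s s') s := by
  have hcap : (RealExpr.mul (effPrice (idxVar 2) (idxVar 6))
      (.read 6 (idxVar 7) (idxVar 6))).eval s = s.cost b * s.stock b := by
    simp [hL.buyer, hL.good, hL.holder, State.cost, State.stock]
  set s₁ : State := ⟨write s.idx 10 0 0 b,
    write (write s.real 7 0 0 1) 8 0 0 (s.cost b * s.stock b)⟩ with hs₁
  have hG₁ : Good n m ε u c B e s₁ := H.congr (by simp [hs₁]) (by simp [hs₁])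
  have hn : s₁.next = s.next := State.next_congr (by simp [hs₁])
  have hf : s₁.fav = s.fav := State.fav_congr (by simp [hs₁])
  have hc : s₁.cost = s.cost := State.cost_congr (by simp [hs₁]) (by simp [hs₁]) (by simp [hs₁])
  have hst : s₁.stock = s.stock := by
    funext x
    rw [State.stock, State.stock, hn, hf]
    simp [hs₁]
  have hp := hG₁.probe_around (b := b) hd (by rwa [hn]) (by rwa [hn]) (by rwa [hn, hst])
    (by simp [hs₁, hL.buyer]) (by simp [hs₁]) (by simp [hs₁]) (by rw [hc, hst]; simp [hs₁])
  have hstate : Total (.seq (around probe) <| .seq chooseAmount <|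
      .seq (around push) (setIdxVar 3 (.lit 0))) (fun t s' => t ≤ d * 490 + 200 ∧
      Circulated n m ε u c B e b s s') s₁ := by
    rw [total_seq]
    refine hp.mono ?_
    have hfa : s₁.factor = s.factor := by
      funext x i
      rw [State.factor, State.factor, hn, State.gain_congr (s := s) (s' := s₁) (by simp [hs₁])
        (by simp [hs₁])]
    rw [hn, hc, hst, hfa]
    rintro t₂ s₂ ⟨ht₂, hi₂, hr₂, h2₂, h7₂, h8₂, hle₂, l₀, hl₀, heq₂⟩
    have hi₂' : ∀ a, a ∉ [2, 3, 6, 7, 10] → s₂.idx a = s.idx a := by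
      intro a ha
      simp only [List.mem_cons, List.not_mem_nil, or_false, not_or] at ha
      rw [hi₂ a (by simp [ha]), hs₁]
      simp [ha]
    have hr₂' : ∀ a, a ∉ [7, 8, 9] → s₂.real a = s.real a := by
      intro a ha
      rw [hr₂ a ha, hs₁]
      simp only [List.mem_cons, List.not_mem_nil, or_false, not_or] at ha
      simp [ha]
    have hi45 : ∀ a ∈ [4, 5], s₂.idx a = s.idx a := by
      intro a ha
      simp only [List.mem_cons, List.not_mem_nil, or_false] at ha
      rcases ha with rfl | rfl <;> exact hi₂' _ (by simp)
    set γ := s.factor b d with hγ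
    set θ := s₂.real 8 0 0 with hθ
    have hfin : ∀ φ, 0 ≤ φ → φ ≤ θ → 0 ≤ s.real 1 b 0 - φ + φ * γ →
        (φ = θ ∨ s.real 1 b 0 - φ + φ * γ = 0) →
        Total (.seq (around push) (setIdxVar 3 (.lit 0))) (fun t s' => t ≤ d * 270 + 10 ∧
          Circulated n m ε u c B e b s s')
          ⟨s₂.idx, write s₂.real 7 0 0 φ⟩ := by
      intro φ hφ hφθ hrest hcase
      set s₃ : State := ⟨s₂.idx, write s₂.real 7 0 0 φ⟩ with hs₃
      have hr₃ : ∀ a, a ∉ [7, 8, 9] → s₃.real a = s.real a := by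
        intro a ha
        rw [← hr₂' a ha, hs₃]
        simp only [List.mem_cons, List.not_mem_nil, or_false, not_or] at ha
        simp [ha]
      have hG₃ : Good n m ε u c B e s₃ := H.congr
        (by
          intro a ha
          simp only [List.mem_cons, List.not_mem_nil, or_false] at ha
          rcases ha with rfl | rfl | rfl | rfl <;> exact hi₂' _ (by simp))
        (by
          intro a ha
          simp only [List.mem_cons, List.not_mem_nil, or_false] at ha
          rcases ha with rfl | rfl | rfl | rfl | rfl | rfl | rfl <;> exact hr₃ _ (by simp))
      have hn₃ : s₃.next = s.next := State.next_congr hi45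
      have hf₃ : s₃.fav = s.fav := State.fav_congr (hi45 5 (by simp))
      have hc₃ : s₃.cost = s.cost :=
        State.cost_congr (hi45 5 (by simp)) (hr₃ 3 (by simp)) (hr₃ 4 (by simp))
      have hst₃ : s₃.stock = s.stock := by
        funext x
        rw [State.stock, State.stock, hn₃, hf₃, hr₃ 6 (by simp)]
      have hfa₃ : s₃.factor = s.factor := by
        funext x i
        rw [State.factor, State.factor, hn₃, State.gain_congr (s := s) (s' := s₃) hi45 (by
          intro a ha
          simp only [List.mem_cons, List.not_mem_nil, or_false] at ha
          rcases ha with rfl | rfl | rfl <;> exact hr₃ _ (by simp))]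
      have hpush := hG₃.push_around (b := b) hd (by rwa [hn₃]) (by rwa [hn₃]) (by rwa [hn₃])
        (by rw [hn₃]; exact fun i => (hw i).1) h2₂
        (by rw [show s₃.idx 10 = s₁.idx 10 from hi₂ 10 (by simp)]; simp [hs₁])
        (φ := φ) (by simp [hs₃]) hφ (by
          rw [hn₃, hc₃, hst₃, hfa₃]
          exact fun l hl => (mul_le_mul_of_nonneg_right hφθ
            (H.factor_pos (fun i => (hw i).1) l).le).trans (hle₂ l hl))
      rw [hn₃, hc₃, hst₃, hfa₃, hf₃, hr₃ 1 (by simp), hr₃ 6 (by simp)] at hpush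
      rw [total_seq]
      refine hpush.mono ?_
      rintro t₄ s₄ ⟨ht₄, hG₄, hi₄, h2₄, h1₄, hmono₄, hdone₄⟩
      have h1b : s₄.real 1 b 0 = s.real 1 b 0 - φ + φ * γ := by
        rw [h1₄, if_pos rfl, if_pos rfl]
      have h1o : ∀ i, i ≠ b → s₄.real 1 i 0 = s.real 1 i 0 := by
        intro i hib
        rw [h1₄, if_neg hib, if_neg hib]
        ring
      have hbm : b ∈ moneyed n fun i => s.real 1 i 0 := mem_moneyed.2 ⟨hb, hrb⟩
      have hsub : (moneyed n fun i => s₄.real 1 i 0) ⊆ moneyed n fun i => s.real 1 i 0 := by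
        intro i hi
        by_cases hib : i = b
        · rw [hib]
          exact hbm
        · have hi := mem_moneyed.1 hi
          exact mem_moneyed.2 ⟨hi.1, by rw [← h1o i hib]; exact hi.2⟩
      simp only [total_setIdx, IdxExpr.eval, IdxExpr.cost, Circulated]
      refine ⟨by omega, hG₄.congr (by simp) (by simp), ?_, ?_, ?_, by simp,
        Finset.card_le_card (held_subset hmono₄), Finset.card_le_card hsub, ?_⟩
      · intro a ha
        rw [← hi₂' a ha]
        simp only [List.mem_cons, List.not_mem_nil, or_false, not_or] at ha
        rw [write_other _ ha.2.1, hi₄ a (by simp [ha])]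
      · intro i hi
        by_cases hib : i = b
        · rw [hib]
          show 0 ≤ s₄.real 1 b 0
          rw [h1b]
          exact hrest
        · show 0 ≤ s₄.real 1 i 0
          rw [h1o i hib]
          exact hr i hi
      · simp [h2₄]
      · rcases hcase with hcase | hcase
        · left
          have h0 := hdone₄ l₀ hl₀ (by rw [hcase, heq₂])
          refine held_card_lt hmono₄ (hw (l₀ + 1)).1.le (H.fav_lt (hw l₀).1) ?_ h0
          have := (hw l₀).2
          rwa [State.stock, ← Function.iterate_succ_apply' s.next] at this
        · right
          refine Finset.card_lt_card ((Finset.ssubset_iff_of_subset hsub).2 ⟨b, hbm, ?_⟩)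
          intro hbm'
          have := (mem_moneyed.1 hbm').2
          rw [h1b, hcase] at this
          exact lt_irrefl _ this
    have hrb₂ : s₂.real 1 b 0 = s.real 1 b 0 := by rw [hr₂' 1 (by simp)]
    rw [total_seq, chooseAmount, total_ite]
    refine ⟨fun hlt => ?_, fun hlt => ?_⟩
    · obtain ⟨h1, h2⟩ : γ < 1 ∧ s.real 1 b 0 < θ * (1 - γ) := by
        simpa [h7₂, h2₂, hrb₂, ← hθ] using hlt
      have hpos : 0 < 1 - γ := by linarith
      rw [total_setReal]
      have hv : (RealExpr.div (.read 1 (idxVar 2) (.lit 0)) (.sub (.lit 1) (realVar 7))).eval s₂ =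
          s.real 1 b 0 / (1 - γ) := by
        simp [h7₂, h2₂, hrb₂]
      rw [hv]
      have h0 : s.real 1 b 0 - s.real 1 b 0 / (1 - γ) + s.real 1 b 0 / (1 - γ) * γ = 0 := by
        field_simp
        ring
      refine (hfin (s.real 1 b 0 / (1 - γ)) (div_pos hrb hpos).le ?_ h0.ge (Or.inr h0)).mono ?_
      · rw [div_le_iff₀ hpos]
        exact h2.le
      · rintro t s' ⟨ht, h⟩
        refine ⟨?_, h⟩
        simp only [IdxExpr.cost, RealExpr.cost, Test.cost]
        omega
    · have h1 : γ < 1 → θ * (1 - γ) ≤ s.real 1 b 0 := by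
        simpa [h7₂, h2₂, hrb₂, ← hθ] using hlt
      rw [total_setReal]
      refine (hfin θ h8₂.le le_rfl ?_ (Or.inl rfl)).mono ?_
      · rcases lt_or_ge γ 1 with h | h
        · linarith [h1 h]
        · nlinarith
      · rintro t s' ⟨ht, h⟩
        refine ⟨?_, h⟩
        simp only [IdxExpr.cost, RealExpr.cost, Test.cost]
        omega
  rw [RealRAM.circulate, total_seq, total_setIdx, total_seq, total_setReal, total_seq,
    total_setReal]
  have hs : (⟨write s.idx 10 0 0 (s.idx 2 0 0), write (write s.real 7 0 0 ((1 : ℕ) : ℝ)) 8 0 0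
      (capacity.eval ⟨write s.idx 10 0 0 (s.idx 2 0 0), write s.real 7 0 0 ((1 : ℕ) : ℝ)⟩)⟩ : State)
      = s₁ := by
    rw [hs₁, ← hcap]
    simp [hL.buyer]
  simp only [IdxExpr.eval, RealExpr.eval.eq_1]
  rw [hs]
  refine hstate.mono ?_
  rintro t s' ⟨ht, h⟩
  refine ⟨?_, h⟩
  simp only [IdxExpr.cost, RealExpr.cost]
  omega

end

/-! ### Raising a price -/

section

variable {n m : ℕ} {ε : ℝ} {u c : ℕ → ℕ → ℝ} {B : ℕ → ℝ} {e : ℕ → ℕ} {s s' : State} {b : ℕ}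

theorem replayMatch_spec {i v : ℕ} {val : ℕ → ℝ} (h8 : s.idx 8 0 0 = i) (h9 : s.idx 9 0 0 = v)
    (hval : ∀ j, val j = s.real 2 i j / (s.real 4 j 0 + s.real 3 i j)) :
    Total replayMatch (fun t s' => t ≤ 200 ∧ s'.real = s.real ∧
      (∀ a, a ≠ 5 → s'.idx a = s.idx a) ∧ (∀ i', i' ≠ i → s'.idx 5 i' = s.idx 5 i') ∧
      s'.idx 5 i = fun v' => if v' = v then
        (if val (s.idx 5 i (2 * v)) < val (s.idx 5 i (2 * v + 1)) then s.idx 5 i (2 * v + 1)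
          else s.idx 5 i (2 * v)) else s.idx 5 i v') s := by
  rw [replayMatch, total_ite]
  simp only [Test.Holds, total_setIdx, IdxExpr.eval, RealExpr.eval, IdxExpr.cost, RealExpr.cost,
    Test.cost, h8, h9, ← two_mul, ← hval]
  refine ⟨fun hlt => ⟨by norm_num, trivial, fun a ha => write_other _ ha _ _ _, ?_, ?_⟩,
    fun hlt => ⟨by norm_num, trivial, fun a ha => write_other _ ha _ _ _, ?_, ?_⟩⟩
  · intro i' hi'
    funext v'
    simp [hi']
  · funext v'
    simp [hlt]
  · intro i' hi'
    funext v'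
    simp [hi']
  · funext v'
    simp [hlt]

theorem replayUp_spec {i v L : ℕ} {val : ℕ → ℝ} (h8 : s.idx 8 0 0 = i) (h9 : s.idx 9 0 0 = v)
    (hval : ∀ j, val j = s.real 2 i j / (s.real 4 j 0 + s.real 3 i j)) (hv : v < m)
    (hL : m ≤ 2 ^ L) (H : Tournament m val (s.idx 5 i) v) :
    Total replayUp (fun t s' => t ≤ L * 230 + 10 ∧ s'.real = s.real ∧
      (∀ a, a ∉ [5, 9] → s'.idx a = s.idx a) ∧ (∀ i', i' ≠ i → s'.idx 5 i' = s.idx 5 i') ∧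
      Tournament m val (s'.idx 5 i) 0) s := by
  refine (total_loop (fun N s' => s'.real = s.real ∧
      (∀ a, a ∉ [5, 9] → s'.idx a = s.idx a) ∧ (∀ i', i' ≠ i → s'.idx 5 i' = s.idx 5 i') ∧
      s'.idx 9 0 0 < m ∧ Tournament m val (s'.idx 5 i) (s'.idx 9 0 0) ∧
      ∃ k, s'.idx 9 0 0 < 2 ^ k ∧ N = k * 230) ?_ (N := L * 230)
      ⟨rfl, fun _ _ => rfl, fun _ _ => rfl, h9 ▸ hv, h9 ▸ H, L, by omega, rfl⟩).mono ?_
  · rintro N s₁ ⟨hr, hi, ho, hlt, hT, k, hk, rfl⟩ hpos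
    have hpos : 0 < s₁.idx 9 0 0 := hpos
    rw [total_seq]
    refine (replayMatch_spec (by rw [hi 8 (by simp), h8]) rfl (by rw [hr]; exact hval)).mono ?_
    rintro t s₂ ⟨ht, hr₂, hi₂, ho₂, hW₂⟩
    have h9₂ : s₂.idx 9 = s₁.idx 9 := hi₂ 9 (by simp)
    simp only [total_setIdx, IdxExpr.eval, IdxExpr.cost, h9₂]
    cases k with
    | zero =>
      rw [pow_zero] at hk
      omega
    | succ k =>
      rw [pow_succ] at hk
      refine ⟨k * 230, ⟨by rw [hr₂, hr], ?_, ?_, ?_, ?_, k, ?_, rfl⟩, ?_⟩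
      · intro a ha
        have ha' := ha
        simp only [List.mem_cons, List.not_mem_nil, or_false, not_or] at ha'
        rw [write_other _ ha'.2, hi₂ a ha'.1, hi a ha]
      · intro i' hi'
        rw [write_other _ (by simp), ho₂ i' hi', ho i' hi']
      · rw [write_same, if_pos ⟨rfl, rfl⟩]
        omega
      · rw [write_same, if_pos ⟨rfl, rfl⟩, write_other _ (by simp)]
        exact hT.replay hpos hlt hW₂
      · rw [write_same, if_pos ⟨rfl, rfl⟩]
        omega
      · simp only [Test.cost, IdxExpr.cost]
        omega
  · rintro t s' ⟨N', ⟨hr, hi, ho, -, hT, -⟩, hz, ht⟩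
    have hz : ¬ 0 < s'.idx 9 0 0 := hz
    rw [show s'.idx 9 0 0 = 0 by omega] at hT
    refine ⟨?_, hr, hi, ho, hT⟩
    simp only [Test.cost, IdxExpr.cost] at ht
    omega

/-- Once all holdings of the located good at its previous price are used up, its price is raised,
the holdings at its current price become the holdings at its previous price, and the tournaments
are repaired. -/
theorem Good.raisePrice (H : Good n m ε u c B e s) {L : ℕ} (hL : m ≤ 2 ^ L) {j : ℕ}
    (hj : s.idx 6 0 0 = j) (hjm : j < m) (h0 : ∀ i ≤ n, s.real 6 i j = 0)
    (hr : ∀ i < n, 0 ≤ s.real 1 i 0) :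
    Total raisePrice (fun t s' => t ≤ n * (L * 230 + 150) + 100 ∧
      Good n m ε u c B (fun l => if l = j then e j + 1 else e l) s' ∧
      s'.real 1 = s.real 1 ∧ s'.idx 2 = s.idx 2 ∧ s'.idx 3 0 0 = 0 ∧
      (∀ l, s'.idx 4 l 0 = if l = j then 0 else s.idx 4 l 0) ∧
      (held n m (s'.real 6)).card ≤ (held n m (s.real 6)).card + n) s := by
  have hεr := H.eps_eq
  have hpj := H.auction.price_pos H.eps_pos hjm
  set p' : ℕ → ℝ := fun l => if l = j then s.real 4 j 0 * (1 + ε) else s.real 4 l 0 with hp'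
  have key := total_loop_count
    (b := .idxLt (idxVar 8) (idxVar 0))
    (P := .seq (.setReal 6 (idxVar 8) (idxVar 6) (.read 5 (idxVar 8) (idxVar 6))) <|
      .seq (.setReal 5 (idxVar 8) (idxVar 6) (.lit 0)) <|
      .seq (setIdxVar 9 (.half (.add (idxVar 1) (idxVar 6)))) <|
      .seq replayUp (incr 8))
    (fun i s' => s'.idx 8 0 0 = i ∧ (∀ a, a ∉ [3, 4, 5, 8, 9] → s'.idx a = s.idx a) ∧
      s'.idx 3 0 0 = 0 ∧ (∀ l, s'.idx 4 l 0 = if l = j then 0 else s.idx 4 l 0) ∧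
      (∀ a, a ∉ [4, 5, 6] → s'.real a = s.real a) ∧ (∀ l, s'.real 4 l 0 = p' l) ∧
      (∀ i' l, s'.real 5 i' l = if l = j ∧ i' < i then 0 else s.real 5 i' l) ∧
      (∀ i' l, s'.real 6 i' l = if l = j ∧ i' < i then s.real 5 i' j else s.real 6 i' l) ∧
      ∀ i' < n, Tournament m (fun l => u i' l / (p' l + c i' l)) (s'.idx 5 i')
        (if i' < i then 0 else (m + j) / 2)) (L * 230 + 140) n ?_ ?_
    (i := 0) (s := ⟨write (write (write s.idx 4 j 0 0) 3 0 0 0) 8 0 0 0,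
      write s.real 4 j 0 (s.real 4 j 0 * (1 + ε))⟩) (Nat.zero_le n) ?_
  · rw [RealRAM.raisePrice, total_seq, total_setReal, total_seq, total_setIdx, total_seq,
      total_setIdx, total_seq, total_setIdx]
    have hs : ∀ v, v = s.real 4 j 0 * (1 + ε) →
        (⟨write (write (write s.idx 4 (s.idx 6 0 0) 0 0) 3 0 0 0) 8 0 0 0,
          write s.real 4 (s.idx 6 0 0) 0 v⟩ : State) =
        ⟨write (write (write s.idx 4 j 0 0) 3 0 0 0) 8 0 0 0,
          write s.real 4 j 0 (s.real 4 j 0 * (1 + ε))⟩ := by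
      rintro v rfl
      rw [hj]
    simp only [IdxExpr.eval]
    rw [hs _ (by simp [hj, hεr])]
    refine key.mono ?_
    rintro t s' ⟨ht, -, hi, h3, h4, hrl, hp, hy, hh, hT⟩
    have hcost : (Test.idxLt (idxVar 8) (idxVar 0)).cost = 7 := rfl
    rw [hcost, Nat.sub_zero] at ht
    have hrl' : ∀ a ∈ [0, 1, 2, 3], s'.real a = s.real a := fun a ha => hrl a (by
      simp only [List.mem_cons, List.not_mem_nil, or_false] at ha
      rcases ha with rfl | rfl | rfl | rfl <;> simp)
    have hyn : s.real 5 n j = 0 := H.auction.y_seller j hjm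
    refine ⟨?_, ?_, hrl' 1 (by simp), hi 2 (by simp), h3, h4, ?_⟩
    · simp only [IdxExpr.cost, RealExpr.cost]
      have : n * (L * 230 + 140 + 1 + 7) ≤ n * (L * 230 + 150) := Nat.mul_le_mul_left _ (by omega)
      omega
    · have hA := H.auction.raise H.eps_pos H.cost_nonneg H.util_nonneg hr hjm h0 rfl
        (p' := fun l => s'.real 4 l 0) (y' := s'.real 5) (h' := s'.real 6) hp
        (by
          intro i hin l
          rw [hy]
          by_cases hlj : l = j
          · subst hlj
            rcases hin.lt_or_eq with h | h
            · simp [h]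
            · simp [h, hyn]
          · simp [hlj])
        (by
          intro i hin l
          rw [hh]
          by_cases hlj : l = j
          · subst hlj
            rcases hin.lt_or_eq with h | h
            · simp [h]
            · simp [h, hyn, h0 n le_rfl]
          · simp [hlj])
      refine ⟨H.goods_pos, H.eps_pos, H.util_nonneg, H.cost_nonneg, hi 0 (by simp) ▸ H.n_eq,
        hi 1 (by simp) ▸ H.m_eq, hrl' 0 (by simp) ▸ H.eps_eq, hrl' 2 (by simp) ▸ H.util_eq,
        hrl' 3 (by simp) ▸ H.cost_eq, by rw [hrl' 1 (by simp)]; exact hA, ?_, ?_, ?_⟩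
      · intro i hin
        have := hT i hin
        simp only [hp]
        rwa [if_pos hin] at this
      · intro l hl
        rw [h4]
        split_ifs
        · omega
        · exact H.pos_le l hl
      · intro l hl k hk
        rw [h4] at hk
        by_cases hlj : l = j
        · simp [hlj] at hk
        · rw [if_neg hlj] at hk
          rw [hh, if_neg (fun h => hlj h.1)]
          exact H.pos_spec l hl k hk
    · have hsub : held n m (s'.real 6) ⊆ held n m (s.real 6) ∪ Finset.range n ×ˢ {j} := by
        rintro ⟨k, l⟩ hx
        have hx := mem_held.1 hx
        by_cases hkl : l = j ∧ k < n
        · refine Finset.mem_union_right _ ?_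
          rw [Finset.mem_product]
          exact ⟨Finset.mem_range.2 hkl.2, Finset.mem_singleton.2 hkl.1⟩
        · refine Finset.mem_union_left _ (mem_held.2 ⟨hx.1, ?_⟩)
          have h1 := hx.2
          rwa [hh, if_neg hkl] at h1
      refine (Finset.card_le_card hsub).trans ((Finset.card_union_le _ _).trans ?_)
      simp
  · rintro i s' ⟨h8, hi, -⟩
    simp only [Test.Holds, IdxExpr.eval, h8, hi 0 (by simp), H.n_eq]
  · rintro i s₁ hin ⟨h8, hi, h3, h4, hrl, hp, hy, hh, hT⟩
    have h6 : s₁.idx 6 0 0 = j := by rw [hi 6 (by simp), hj]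
    have h1 : s₁.idx 1 0 0 = m := by rw [hi 1 (by simp), H.m_eq]
    simp only [total_seq (P := .setReal _ _ _ _), total_seq (P := setIdxVar _ _), total_setReal,
      total_setIdx, IdxExpr.eval, RealExpr.eval, h8, h6, h1]
    rw [total_seq]
    refine (replayUp_spec (i := i) (v := (m + j) / 2) (L := L) (m := m)
      (val := fun l => u i l / (p' l + c i l)) (by simp [h8]) (by simp) ?_ (by omega) hL ?_).mono ?_
    · intro l
      simp only [ne_eq, Nat.reduceEqDiff, not_false_eq_true, write_other, 
        hp, hrl 2 (by simp), hrl 3 (by simp), H.util_eq, H.cost_eq]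
    · have := hT i hin
      rw [if_neg (lt_irrefl i)] at this
      simpa using this
    · rintro t s₂ ⟨ht, hr₂, hi₂, ho₂, hT₂⟩
      have h8₂ : s₂.idx 8 0 0 = i := by
        rw [hi₂ 8 (by simp)]
        simp [h8]
      simp only [total_setIdx, IdxExpr.eval, IdxExpr.cost, RealExpr.cost]
      refine ⟨by omega, ?_, ?_, ?_, ?_, ?_, ?_, ?_, ?_, ?_⟩
      · simp [h8₂]
      · intro a ha
        have ha' := ha
        simp only [List.mem_cons, List.not_mem_nil, or_false, not_or] at ha'
        rw [write_other _ ha'.2.2.2.1, hi₂ a (by simp [ha']), ← hi a ha]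
        simp [ha']
      · rw [write_other _ (by simp), hi₂ 3 (by simp)]
        simp [h3]
      · intro l
        rw [write_other _ (by simp), hi₂ 4 (by simp)]
        simp [h4]
      · intro a ha
        rw [hr₂, ← hrl a ha]
        simp only [List.mem_cons, List.not_mem_nil, or_false, not_or] at ha
        simp [ha]
      · intro l
        simp [hr₂, hp]
      · intro i' l
        simp only [hr₂, write_same]
        by_cases hl : l = j
        · by_cases h1 : i' = i
          · simp [h1, hl]
          · have : i' < i + 1 ↔ i' < i := by omega
            simp [h1, hl, hy, this]
        · simp [hl, hy]
      · intro i' l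
        rw [hr₂]
        simp only [ne_eq, Nat.reduceEqDiff, not_false_eq_true, write_other, write_same]
        by_cases hl : l = j
        · by_cases h1 : i' = i
          · simp [h1, hl, hy]
          · have : i' < i + 1 ↔ i' < i := by omega
            simp [h1, hl, hh, this]
        · simp [hl, hh]
      · intro i' hi'
        rw [write_other _ (by simp)]
        by_cases h1 : i' = i
        · rw [if_pos (by omega), h1]
          exact hT₂
        · rw [ho₂ i' h1]
          have := hT i' hi'
          have h2 : i' < i + 1 ↔ i' < i := by omega
          simpa [h2] using this
  · refine ⟨by simp, ?_, by simp, ?_, ?_, ?_, by simp, by simp, ?_⟩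
    · intro a ha
      simp only [List.mem_cons, List.not_mem_nil, or_false, not_or] at ha
      simp [ha]
    · intro l
      simp
    · intro a ha
      simp only [List.mem_cons, List.not_mem_nil, or_false, not_or] at ha
      simp [ha]
    · intro l
      simp [hp']
    · intro i' hi'
      rw [if_neg (Nat.not_lt_zero i')]
      simp only [ne_eq, Nat.reduceEqDiff, not_false_eq_true, write_other]
      refine (H.tree i' hi').change fun l _ hl => ?_
      simp [hp', hl]

/-! ### Choosing the current buyer -/

theorem rescan_spec (hn : s.idx 0 0 0 = n) :
    Total rescan (fun t s' => t ≤ n * 30 + 60 ∧ s'.real = s.real ∧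
      (∀ a, a ∉ [2, 3] → s'.idx a = s.idx a) ∧ s'.idx 3 0 0 = 0 ∧
      ((s'.idx 2 0 0 < n ∧ 0 < s.real 1 (s'.idx 2 0 0) 0) ∨
        (s'.idx 2 0 0 = n ∧ ∀ i < n, ¬ 0 < s.real 1 i 0))) s := by
  rw [rescan, total_seq, total_setIdx, total_seq, total_setIdx]
  refine (total_loop (fun N s' => s'.real = s.real ∧
      (∀ a, a ∉ [2, 3] → s'.idx a = s.idx a) ∧ s'.idx 3 0 0 = 0 ∧ s'.idx 2 0 0 ≤ n ∧
      (∀ i < s'.idx 2 0 0, ¬ 0 < s.real 1 i 0) ∧ N = (n - s'.idx 2 0 0) * 30) ?_ (N := n * 30)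
      ?_).mono ?_
  · rintro N s₁ ⟨hr, hi, h3, hle, hz, rfl⟩ hb
    simp only [Test.Holds, IdxExpr.eval, RealExpr.eval, hi 0 (by simp), hn, hr,
      Nat.cast_zero] at hb
    simp only [total_setIdx, IdxExpr.eval, IdxExpr.cost]
    refine ⟨(n - (s₁.idx 2 0 0 + 1)) * 30, ⟨hr, ?_, by simp [h3], ?_, ?_, by simp⟩, ?_⟩
    · intro a ha
      have ha' := ha
      simp only [List.mem_cons, List.not_mem_nil, or_false, not_or] at ha'
      rw [write_other _ ha'.1, hi a ha]
    · simp only [write_same, and_self, if_true]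
      omega
    · simp only [write_same, and_self, if_true]
      intro i hi'
      rcases Nat.lt_succ_iff_lt_or_eq.1 hi' with h | h
      · exact hz i h
      · rw [h]
        exact hb.2
    · simp only [Test.cost, IdxExpr.cost, RealExpr.cost]
      omega
  · refine ⟨rfl, ?_, by simp, by simp, by simp, by simp⟩
    intro a ha
    simp only [List.mem_cons, List.not_mem_nil, or_false, not_or] at ha
    simp [ha]
  · rintro t s' ⟨N', ⟨hr, hi, h3, hle, hz, -⟩, hb, ht⟩
    simp only [Test.cost, IdxExpr.cost, RealExpr.cost] at ht ⊢
    refine ⟨by omega, hr, hi, h3, ?_⟩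
    simp only [Test.Holds, IdxExpr.eval, RealExpr.eval, hi 0 (by simp), hn, hr,
      Nat.cast_zero, not_and, not_not] at hb
    rcases hle.lt_or_eq with h | h
    · exact Or.inl ⟨h, hb h⟩
    · exact Or.inr ⟨h, h ▸ hz⟩

end

/-! ### The potential of the auction -/

/-- The potential that pays for the operations, up to the part for the length of the current walk:
`R` raises, `H` holdings at previous prices, `Q` positions of the holder lists, and `T` buyers with
money are left. A raise produces up to `n` holdings and `n + 1` positions, and costs a tournament
repair for every buyer; using up a holding may produce a buyer with money; and each of these events
but the raise may cost a trade around a cycle or a search for the next buyer. -/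
def potential (n L R H Q T : ℕ) : ℕ :=
  20000 * ((n + 1) * (n + 1 + L)) * R + 6000 * (n + 1) * H + 3000 * (n + 1) * Q +
    3000 * (n + 1) * T

theorem potential_mono {n L R H Q T R' H' Q' T' : ℕ} (hR : R' ≤ R) (hH : H' ≤ H) (hQ : Q' ≤ Q)
    (hT : T' ≤ T) : potential n L R' H' Q' T' ≤ potential n L R H Q T := by
  unfold potential
  gcongr

theorem potential_raise {n L R H Q T R' H' Q' T' : ℕ} (hR : R' < R) (hH : H' ≤ H + n)
    (hQ : Q' ≤ Q + (n + 1)) (hT : T' ≤ T) :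
    potential n L R' H' Q' T' + n * (L * 230 + 150) + 3000 * (n + 1) ≤
      potential n L R H Q T := by
  unfold potential
  have h1 := Nat.mul_le_mul_left (20000 * ((n + 1) * (n + 1 + L))) (Nat.succ_le_of_lt hR)
  have h2 := Nat.mul_le_mul_left (6000 * (n + 1)) hH
  have h3 := Nat.mul_le_mul_left (3000 * (n + 1)) hQ
  have h4 := Nat.mul_le_mul_left (3000 * (n + 1)) hT
  have h5 : 0 ≤ n * L := Nat.zero_le _
  have h6 : 0 ≤ n * n := Nat.zero_le _
  rw [Nat.succ_eq_add_one] at h1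
  nlinarith

theorem potential_advance {n L R H Q T Q' : ℕ} (hQ : Q' < Q) :
    potential n L R H Q' T + 3000 * (n + 1) ≤ potential n L R H Q T := by
  unfold potential
  have h3 := Nat.mul_le_mul_left (3000 * (n + 1)) (Nat.succ_le_of_lt hQ)
  rw [Nat.succ_eq_add_one] at h3
  linarith

theorem potential_exhaust {n L R H Q T H' T' : ℕ} (hH : H' < H) (hT : T' ≤ T + 1) :
    potential n L R H' Q T' + 3000 * (n + 1) ≤ potential n L R H Q T := by
  unfold potential
  have h2 := Nat.mul_le_mul_left (6000 * (n + 1)) (Nat.succ_le_of_lt hH)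
  have h4 := Nat.mul_le_mul_left (3000 * (n + 1)) hT
  rw [Nat.succ_eq_add_one] at h2
  linarith

theorem potential_spent {n L R H Q T H' T' : ℕ} (hH : H' ≤ H) (hT : T' < T) :
    potential n L R H' Q T' + 3000 * (n + 1) ≤ potential n L R H Q T := by
  unfold potential
  have h2 := Nat.mul_le_mul_left (6000 * (n + 1)) hH
  have h4 := Nat.mul_le_mul_left (3000 * (n + 1)) (Nat.succ_le_of_lt hT)
  rw [Nat.succ_eq_add_one] at h4
  linarith

/-- The potential of a memory in which good `j` has been raised `e j` times, if no good can be
raised more than `K` times. -/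
noncomputable def State.pot (n m K L : ℕ) (e : ℕ → ℕ) (s : State) : ℕ :=
  potential n L (∑ j ∈ Finset.range m, (K - e j)) (held n m (s.real 6)).card
    (∑ j ∈ Finset.range m, (n + 1 - s.idx 4 j 0)) (moneyed n fun i => s.real 1 i 0).card

/-- The last trades, as many as scalar `3` says, handed the money on along the walk from each buyer
to the holder of the favourite good, without using up a holding. -/
def State.Chain (n : ℕ) (s : State) : Prop :=
  ∃ a, s.next^[s.idx 3 0 0] a = s.idx 2 0 0 ∧
    ∀ i < s.idx 3 0 0, s.next^[i] a < n ∧ 0 < s.stock (s.next^[i] a)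

theorem State.chain_zero {n : ℕ} {s : State} (h : s.idx 3 0 0 = 0) : s.Chain n :=
  ⟨s.idx 2 0 0, by simp [h], by simp [h]⟩

section

variable {n m : ℕ} {ε : ℝ} {u c : ℕ → ℕ → ℝ} {B : ℕ → ℝ} {e : ℕ → ℕ} {s s' : State} {b K L : ℕ}

theorem sum_change_le {f f' : ℕ → ℕ} {j k : ℕ} (hj : j < m)
    (h : ∀ l, f' l ≤ f l + if l = j then k else 0) :
    ∑ l ∈ Finset.range m, f' l ≤ ∑ l ∈ Finset.range m, f l + k := by
  refine (Finset.sum_le_sum fun l _ => h l).trans ?_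
  rw [Finset.sum_add_distrib, Finset.sum_ite_eq', if_pos (Finset.mem_range.2 hj)]

theorem sum_change_lt {f f' : ℕ → ℕ} {j : ℕ} (hj : j < m) (h : ∀ l, f' l ≤ f l)
    (hlt : f' j < f j) : ∑ l ∈ Finset.range m, f' l < ∑ l ∈ Finset.range m, f l :=
  Finset.sum_lt_sum (fun l _ => h l) ⟨j, Finset.mem_range.2 hj, hlt⟩

theorem advance_spec {j k : ℕ} (hj : s.idx 6 0 0 = j) (hk : s.idx 7 0 0 = k) :
    Total advance (fun t s' => t ≤ 30 ∧ s'.real = s.real ∧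
      (∀ a, a ∉ [3, 4] → s'.idx a = s.idx a) ∧ s'.idx 3 0 0 = 0 ∧
      ∀ l, s'.idx 4 l 0 = if l = j then k + 1 else s.idx 4 l 0) s := by
  subst hj hk
  simp only [advance, total_seq, total_setIdx, IdxExpr.eval, IdxExpr.cost]
  refine ⟨by norm_num, trivial, fun a ha => ?_, by simp, by simp⟩
  simp only [List.mem_cons, List.not_mem_nil, or_false, not_or] at ha
  simp [ha]

/-- One round of the auction is paid for by the drop of the potential together with the growth of
the walk. If the current buyer has no money left, so much is dropped that a search for the next
buyer is paid for as well, and that the length of the walk can be forgotten. -/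
theorem Good.act (H : Good n m ε u c B e s) (hL : m ≤ 2 ^ L)
    (hK : ∀ k, k = 0 ∨ ε * (1 + ε) ^ k ≤ (1 + ε) * ∑ i ∈ Finset.range n, B i → k ≤ K)
    (h2 : s.idx 2 0 0 = b) (hb : b < n) (hr : ∀ i < n, 0 ≤ s.real 1 i 0)
    (hrb : 0 < s.real 1 b 0) (hchain : s.Chain n) :
    Total act (fun t s' => ∃ e', Good n m ε u c B e' s' ∧ (∀ i < n, 0 ≤ s'.real 1 i 0) ∧
      (s'.idx 2 0 0 < n ∧ 0 < s'.real 1 (s'.idx 2 0 0) 0 → s'.Chain n ∧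
        t + 100 + s'.pot n m K L e' + 1000 * (n - s'.idx 3 0 0) ≤
          s.pot n m K L e + 1000 * (n - s.idx 3 0 0)) ∧
      (¬ (s'.idx 2 0 0 < n ∧ 0 < s'.real 1 (s'.idx 2 0 0) 0) →
        t + 100 + (n * 30 + 60) + s'.pot n m K L e' + 1000 * n ≤
          s.pot n m K L e + 1000 * (n - s.idx 3 0 0))) s := by
  rw [RealRAM.act, total_seq]
  refine (locate_spec h2).mono ?_
  rintro t₁ s₁ ⟨ht₁, hr₁, hi₁, hloc⟩
  have hi45 : ∀ a ∈ [4, 5], s₁.idx a = s.idx a := by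
    intro a ha
    simp only [List.mem_cons, List.not_mem_nil, or_false] at ha
    rcases ha with rfl | rfl <;> exact hi₁ _ (by simp)
  have hn : s₁.next = s.next := State.next_congr hi45
  have hf : s₁.fav = s.fav := State.fav_congr (hi45 5 (by simp))
  have hst : s₁.stock = s.stock := by
    funext x
    rw [State.stock, State.stock, hn, hf, hr₁]
  have hG : Good n m ε u c B e s₁ := H.congr (by
    intro a ha
    simp only [List.mem_cons, List.not_mem_nil, or_false] at ha
    rcases ha with rfl | rfl | rfl | rfl <;> exact hi₁ _ (by simp)) (by simp [hr₁])
  have hpot : s₁.pot n m K L e = s.pot n m K L e := by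
    rw [State.pot, State.pot, hr₁, hi₁ 4 (by simp)]
  have h3 : s₁.idx 3 = s.idx 3 := hi₁ 3 (by simp)
  have h0 : s₁.idx 0 0 0 = n := hG.n_eq
  rw [← hr₁] at hr hrb
  rw [← hpot, ← h3]
  have hchain : s₁.Chain n := by
    rw [State.Chain, hn, hst, h3, hi₁ 2 (by simp)]
    exact hchain
  clear hpot hn hf hst hi45
  -- it suffices to finish with an empty walk and a large drop of the potential
  have hbig : ∀ t' s' e', Good n m ε u c B e' s' → (∀ i < n, 0 ≤ s'.real 1 i 0) →
      s'.idx 3 0 0 = 0 → t' ≤ n * 490 + 800 →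
      s'.pot n m K L e' + 3000 * (n + 1) ≤ s₁.pot n m K L e →
      ∃ e', Good n m ε u c B e' s' ∧ (∀ i < n, 0 ≤ s'.real 1 i 0) ∧
      (s'.idx 2 0 0 < n ∧ 0 < s'.real 1 (s'.idx 2 0 0) 0 → s'.Chain n ∧
        t' + 100 + s'.pot n m K L e' + 1000 * (n - s'.idx 3 0 0) ≤
          s₁.pot n m K L e + 1000 * (n - s₁.idx 3 0 0)) ∧
      (¬ (s'.idx 2 0 0 < n ∧ 0 < s'.real 1 (s'.idx 2 0 0) 0) →
        t' + 100 + (n * 30 + 60) + s'.pot n m K L e' + 1000 * n ≤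
          s₁.pot n m K L e + 1000 * (n - s₁.idx 3 0 0)) := by
    intro t' s' e' hG' hr' h3' ht' hp'
    refine ⟨e', hG', hr', fun _ => ⟨State.chain_zero h3', ?_⟩, fun _ => ?_⟩
    · omega
    · omega
  have hfav := hG.fav_lt hb
  rw [total_ite]
  refine ⟨fun hlt => ?_, fun hlt => ?_⟩
  · have hlt : n < s₁.next b := by simpa [h0, hloc.holder] using hlt
    have hle : s₁.next b = n + 1 := le_antisymm (hG.next_le hb) hlt
    have hz : ∀ i ≤ n, s₁.real 6 i (s₁.fav b) = 0 := fun i hi =>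
      hG.pos_spec _ hfav i (by
        have : s₁.idx 4 (s₁.fav b) 0 = n + 1 := hle
        omega)
    refine (hG.raisePrice hL hloc.good hfav hz hr).mono ?_
    rintro t s' ⟨ht, hG', h1', h2', h3', h4', hheld⟩
    have hek : e (s₁.fav b) + 1 ≤ K := by
      have hp := hG'.auction.price _ hfav
      have hle := hG'.auction.price_le _ hfav
      simp only [if_true] at hp hle
      rw [hp] at hle
      exact hK _ (hle.imp_left (by omega))
    have hdrop : s'.pot n m K L (fun l => if l = s₁.fav b then e (s₁.fav b) + 1 else e l) +
        n * (L * 230 + 150) + 3000 * (n + 1) ≤ s₁.pot n m K L e := by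
      refine potential_raise ?_ hheld ?_ (by rw [h1'])
      · refine sum_change_lt hfav (fun l => ?_) ?_
        · by_cases h : l = s₁.fav b
          · simp only [h, if_true]
            omega
          · simp [h]
        · simp only [if_true]
          omega
      · refine sum_change_le hfav fun l => ?_
        rw [h4']
        by_cases h : l = s₁.fav b
        · simp [h]
        · simp [h]
    simp only [Test.cost, IdxExpr.cost]
    refine ⟨_, hG', by rw [h1']; exact hr, fun _ => ⟨State.chain_zero h3', ?_⟩, fun hno => ?_⟩
    · omega
    · rw [h2', hloc.buyer, h1'] at hno
      exact absurd ⟨hb, hrb⟩ hno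
  have hle : s₁.next b ≤ n := by simpa [h0, hloc.holder] using hlt
  rw [total_ite]
  refine ⟨fun hstock => ?_, fun hstock => ?_⟩
  swap
  · have hstock : s₁.real 6 (s₁.next b) (s₁.fav b) ≤ 0 := by
      simpa [hloc.good, hloc.holder] using hstock
    have hz : s₁.real 6 (s₁.next b) (s₁.fav b) = 0 :=
      le_antisymm hstock (hG.auction.h_nonneg _ hle _ hfav)
    have hpos : s₁.idx 4 (s₁.fav b) 0 = s₁.next b := rfl
    refine (advance_spec hloc.good hloc.holder).mono ?_
    rintro t s' ⟨ht, hr', hi', h3', h4'⟩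
    have hi5 : s'.idx 5 = s₁.idx 5 := hi' 5 (by simp)
    simp only [Test.cost, IdxExpr.cost, RealExpr.cost]
    refine hbig _ _ e ?_ (by rw [hr']; exact hr) h3' (by omega) ?_
    · refine ⟨hG.goods_pos, hG.eps_pos, hG.util_nonneg, hG.cost_nonneg,
        hi' 0 (by simp) ▸ hG.n_eq, hi' 1 (by simp) ▸ hG.m_eq, by rw [hr']; exact hG.eps_eq,
        by rw [hr']; exact hG.util_eq, by rw [hr']; exact hG.cost_eq,
        by rw [hr']; exact hG.auction, by rw [hr', hi5]; exact hG.tree, ?_, ?_⟩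
      · intro l hl
        rw [h4']
        split_ifs
        · omega
        · exact hG.pos_le l hl
      · intro l hl k hk
        rw [h4'] at hk
        rw [hr']
        by_cases h : l = s₁.fav b
        · rw [if_pos h] at hk
          rcases Nat.lt_succ_iff_lt_or_eq.1 hk with h' | h'
          · exact hG.pos_spec l hl k (by rw [h]; exact h')
          · rw [h', h]
            exact hz
        · rw [if_neg h] at hk
          exact hG.pos_spec l hl k hk
    · rw [State.pot, hr']
      refine potential_advance (sum_change_lt hfav (fun l => ?_) ?_)
      · rw [h4']
        by_cases h : l = s₁.fav b
        · rw [if_pos h, h, hpos]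
          omega
        · rw [if_neg h]
      · rw [h4', if_pos rfl, hpos]
        omega
  have hstock : 0 < s₁.real 6 (s₁.next b) (s₁.fav b) := by
    simpa [hloc.good, hloc.holder] using hstock
  rw [total_ite]
  refine ⟨fun hcnt => ?_, fun hcnt => ?_⟩
  · have hcnt : s₁.idx 3 0 0 < n := by simpa [h0] using hcnt
    refine (hG.trade hloc hb hle hstock hr hrb).mono ?_
    rintro t s' ⟨ht, hG', hi', hr', hcase⟩
    have hi4 : s'.idx 4 = s₁.idx 4 := hi' 4 (by simp)
    have hi5 : s'.idx 5 = s₁.idx 5 := hi' 5 (by simp)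
    simp only [Test.cost, IdxExpr.cost, RealExpr.cost]
    rcases hcase with ⟨h2', h3', hpos, hheld, hlt', heq'⟩ | ⟨h2', h3', hheld, hm'⟩
    · have hn : s'.next = s₁.next := State.next_congr (by simp [hi4, hi5])
      have hf : s'.fav = s₁.fav := State.fav_congr hi5
      refine ⟨e, hG', hr', fun hyes => ⟨?_, ?_⟩, fun hno => ?_⟩
      · obtain ⟨a, ha, hw⟩ := hchain
        refine ⟨a, ?_, ?_⟩
        · rw [h3', hn, h2', Function.iterate_succ_apply', ha, hloc.buyer]
        · intro i hi
          rw [h3'] at hi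
          rw [hn, State.stock, hn, hf]
          rcases Nat.lt_succ_iff_lt_or_eq.1 hi with h | h
          · exact ⟨(hw i h).1, hpos _ _ (hw i h).2⟩
          · rw [h, ha, hloc.buyer]
            exact ⟨hb, hpos _ _ hstock⟩
      · rw [h2'] at hyes
        have hp : s'.pot n m K L e ≤ s₁.pot n m K L e :=
          potential_mono le_rfl hheld (by rw [hi4]) (hlt' hyes.1).2
        rw [h3']
        omega
      · rw [h2'] at hno
        have hkn : s₁.next b = n := by
          rcases hle.lt_or_eq with h | h
          · exact absurd ⟨h, (hlt' h).1⟩ hno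
          · exact h
        have hp : s'.pot n m K L e + 3000 * (n + 1) ≤ s₁.pot n m K L e := by
          rw [State.pot, hi4]
          exact potential_spent hheld (heq' hkn)
        omega
    · refine hbig _ _ e hG' hr' h3' (by omega) ?_
      rw [State.pot, hi4]
      exact potential_exhaust hheld hm'
  · have hcnt : n ≤ s₁.idx 3 0 0 := by simpa [h0] using hcnt
    obtain ⟨a, ha, hw⟩ := hchain
    rw [hloc.buyer] at ha
    obtain ⟨d, hd, hdn, hret, hne, hinj, hall⟩ :=
      exists_cycle s₁.next (fun x => 0 < s₁.stock x) hcnt hw (by rw [ha]; exact hb)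
    rw [ha] at hret hne hinj hall
    refine (hG.circulate hloc hb hd hret hne hinj hall hr hrb).mono ?_
    rintro t s' ⟨ht, hG', hi', hr', h2', h3', hheld, hm', hcase⟩
    have hi4 : s'.idx 4 = s₁.idx 4 := hi' 4 (by simp)
    simp only [Test.cost, IdxExpr.cost, RealExpr.cost]
    refine hbig _ _ e hG' hr' h3' (by omega) ?_
    rw [State.pot, hi4]
    rcases hcase with h | h
    · exact potential_exhaust h (by omega)
    · exact potential_spent hheld h

/-- The auction ends with all money spent, and its operations are paid for by the potential. -/
theorem Good.auction_loop (H : Good n m ε u c B e s) (hL : m ≤ 2 ^ L)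
    (hK : ∀ k, k = 0 ∨ ε * (1 + ε) ^ k ≤ (1 + ε) * ∑ i ∈ Finset.range n, B i → k ≤ K)
    (hr : ∀ i < n, 0 ≤ s.real 1 i 0) (h3 : s.idx 3 0 0 = 0)
    (h2 : (s.idx 2 0 0 < n ∧ 0 < s.real 1 (s.idx 2 0 0) 0) ∨
      (s.idx 2 0 0 = n ∧ ∀ i < n, ¬ 0 < s.real 1 i 0)) :
    Total RealRAM.auction (fun t s' => t ≤ s.pot n m K L e + 1000 * n + 10 ∧
      ∃ e', Good n m ε u c B e' s' ∧ ∀ i < n, s'.real 1 i 0 = 0) s := by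
  refine (total_loop (fun N s' => ∃ e', Good n m ε u c B e' s' ∧
      (∀ i < n, 0 ≤ s'.real 1 i 0) ∧ s'.Chain n ∧
      ((s'.idx 2 0 0 < n ∧ 0 < s'.real 1 (s'.idx 2 0 0) 0) ∨
        (s'.idx 2 0 0 = n ∧ ∀ i < n, ¬ 0 < s'.real 1 i 0)) ∧
      N = s'.pot n m K L e' + 1000 * (n - s'.idx 3 0 0)) ?_
      ⟨e, H, hr, State.chain_zero h3, h2, rfl⟩).mono ?_
  · rintro N s₁ ⟨e₁, hG, hr₁, hchain, h2₁, rfl⟩ hlt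
    have hlt : s₁.idx 2 0 0 < n := by simpa [hG.n_eq] using hlt
    have hrb : 0 < s₁.real 1 (s₁.idx 2 0 0) 0 := by
      rcases h2₁ with h | h
      · exact h.2
      · omega
    rw [total_seq]
    refine (hG.act hL hK rfl hlt hr₁ hrb hchain).mono ?_
    rintro t s₂ ⟨e₂, hG₂, hr₂, hyes, hno⟩
    rw [total_ite]
    have hm : hasMoney.Holds s₂ ↔ s₂.idx 2 0 0 < n ∧ 0 < s₂.real 1 (s₂.idx 2 0 0) 0 := by
      simp [hG₂.n_eq]
    rw [hm]
    refine ⟨fun h => ?_, fun h => ?_⟩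
    · obtain ⟨hch, hp⟩ := hyes h
      rw [total_skip]
      refine ⟨_, ⟨e₂, hG₂, hr₂, hch, Or.inl h, rfl⟩, ?_⟩
      simp only [Test.cost, IdxExpr.cost, RealExpr.cost]
      omega
    · have hp := hno h
      refine (rescan_spec hG₂.n_eq).mono ?_
      rintro t₃ s₃ ⟨ht₃, hr₃, hi₃, h3₃, hcase⟩
      have hpot : s₃.pot n m K L e₂ = s₂.pot n m K L e₂ := by
        rw [State.pot, State.pot, hr₃, hi₃ 4 (by simp)]
      refine ⟨_, ⟨e₂, hG₂.congr (by
        intro a ha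
        simp only [List.mem_cons, List.not_mem_nil, or_false] at ha
        rcases ha with rfl | rfl | rfl | rfl <;> exact hi₃ _ (by simp)) (by simp [hr₃]),
        by rw [hr₃]; exact hr₂, State.chain_zero h3₃, by rw [hr₃]; exact hcase, rfl⟩, ?_⟩
      simp only [Test.cost, IdxExpr.cost, RealExpr.cost]
      rw [hpot, h3₃]
      omega
  · rintro t s' ⟨N', ⟨e', hG, hr', -, h2', -⟩, hz, ht⟩
    have hz : n ≤ s'.idx 2 0 0 := by simpa [hG.n_eq] using hz
    simp only [Test.cost, IdxExpr.cost, h3, Nat.sub_zero] at ht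
    refine ⟨by omega, e', hG, fun i hi => ?_⟩
    rcases h2' with h | h
    · omega
    · exact le_antisymm (not_lt.1 (h.2 i hi)) (hr' i hi)

end

/-! ### Setting up -/

/-- A tournament tree of which only the nodes above number `v₀` have been filled in. -/
structure PartialTournament (m : ℕ) (val : ℕ → ℝ) (W : ℕ → ℕ) (v₀ : ℕ) : Prop where
  lt : ∀ v, v₀ < v → v < 2 * m → W v < m
  above : ∀ v, v₀ < v → v < 2 * m → ∃ d, (m + W v) / 2 ^ d = v
  left : ∀ v, v₀ < v → v < m → val (W (2 * v)) ≤ val (W v)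
  right : ∀ v, v₀ < v → v < m → val (W (2 * v + 1)) ≤ val (W v)

namespace PartialTournament

variable {m : ℕ} {val : ℕ → ℝ} {W W' : ℕ → ℕ} {v₀ : ℕ}

theorem tournament (H : PartialTournament m val W 0) : Tournament m val W 0 :=
  ⟨H.lt, H.above, fun v h1 h2 _ => H.left v h1 h2, fun v h1 h2 _ => H.right v h1 h2⟩

theorem leaves (hW : ∀ j < m, W (m + j) = j) : PartialTournament m val W (m - 1) := by
  have hv : ∀ v, m - 1 < v → v < 2 * m → ∃ j < m, v = m + j ∧ W v = j := by
    intro v h1 h2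
    refine ⟨v - m, by omega, by omega, ?_⟩
    have := hW (v - m) (by omega)
    rwa [show m + (v - m) = v by omega] at this
  refine ⟨fun v h1 h2 => ?_, fun v h1 h2 => ?_, fun v h1 h2 => by omega, fun v h1 h2 => by omega⟩
  · obtain ⟨j, hj, -, h⟩ := hv v h1 h2
    rw [h]
    exact hj
  · obtain ⟨j, hj, h, h'⟩ := hv v h1 h2
    exact ⟨0, by rw [h', pow_zero, Nat.div_one, h]⟩

theorem replay (H : PartialTournament m val W v₀) (h1 : 1 ≤ v₀) (h2 : v₀ < m)
    (hW : W' = fun v => if v = v₀ then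
      (if val (W (2 * v₀)) < val (W (2 * v₀ + 1)) then W (2 * v₀ + 1) else W (2 * v₀)) else W v) :
    PartialTournament m val W' (v₀ - 1) := by
  have hsel : W' v₀ = W (2 * v₀ + 1) ∨ W' v₀ = W (2 * v₀) := by
    rw [hW]
    simp only [if_true]
    split_ifs <;> simp
  have hne : ∀ v, v₀ < v → W' v = W v := by
    intro v hv
    rw [hW]
    simp [hv.ne']
  have hcases : ∀ v, v₀ - 1 < v → v = v₀ ∨ v₀ < v := fun v hv => by omega
  refine ⟨fun v hv1 hv2 => ?_, fun v hv1 hv2 => ?_, fun v hv1 hv2 => ?_, fun v hv1 hv2 => ?_⟩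
  · rcases hcases v hv1 with rfl | hv
    · rcases hsel with h | h <;> rw [h] <;> exact H.lt _ (by omega) (by omega)
    · rw [hne v hv]
      exact H.lt v hv hv2
  · rcases hcases v hv1 with rfl | hv
    · rcases hsel with h | h
      · obtain ⟨d, hd⟩ := H.above (2 * v + 1) (by omega) (by omega)
        refine ⟨d + 1, ?_⟩
        rw [h, pow_succ, ← Nat.div_div_eq_div_mul, hd]
        omega
      · obtain ⟨d, hd⟩ := H.above (2 * v) (by omega) (by omega)
        refine ⟨d + 1, ?_⟩
        rw [h, pow_succ, ← Nat.div_div_eq_div_mul, hd]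
        omega
    · rw [hne v hv]
      exact H.above v hv hv2
  · rw [hne (2 * v) (by omega)]
    rcases hcases v hv1 with rfl | hv
    · rw [hW]
      simp only [if_true]
      split_ifs with h
      · exact h.le
      · exact le_rfl
    · rw [hne v hv]
      exact H.left v hv hv2
  · rw [hne (2 * v + 1) (by omega)]
    rcases hcases v hv1 with rfl | hv
    · rw [hW]
      simp only [if_true]
      split_ifs with h
      · exact le_rfl
      · exact not_lt.1 h
    · rw [hne v hv]
      exact H.right v hv hv2

end PartialTournament

section

variable {n m : ℕ} {ε : ℝ} {u c : ℕ → ℕ → ℝ} {B : ℕ → ℝ} {e : ℕ → ℕ} {s s' : State}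

/-- The part of `setUp` that fills in the tournament of the buyer in scalar `8`. -/
theorem build_row_spec {i : ℕ} (hm : 1 ≤ m) (h1 : s.idx 1 0 0 = m) (h8 : s.idx 8 0 0 = i) :
    Total (.seq (setIdxVar 9 (.lit 0)) <|
      .seq (.loop (.idxLt (idxVar 9) (idxVar 1)) <|
        .seq (.setIdx 5 (idxVar 8) (.add (idxVar 1) (idxVar 9)) (idxVar 9)) (incr 9)) <|
      .seq (setIdxVar 9 (.sub (idxVar 1) (.lit 1))) <|
      .seq (.loop (.idxLt (.lit 0) (idxVar 9)) <|
        .seq replayMatch (setIdxVar 9 (.sub (idxVar 9) (.lit 1))))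
      (incr 8)) (fun t s' => t ≤ m * 280 + 100 ∧ s'.real = s.real ∧ s'.idx 8 0 0 = i + 1 ∧
        (∀ a, a ∉ [5, 8, 9] → s'.idx a = s.idx a) ∧ (∀ i', i' ≠ i → s'.idx 5 i' = s.idx 5 i') ∧
        Tournament m (fun j => s.real 2 i j / (s.real 4 j 0 + s.real 3 i j)) (s'.idx 5 i) 0) s := by
  rw [total_seq, total_setIdx, total_seq]
  refine (total_loop_count (fun v s' => s'.idx 9 0 0 = v ∧ s'.real = s.real ∧
      (∀ a, a ∉ [5, 9] → s'.idx a = s.idx a) ∧ (∀ i', i' ≠ i → s'.idx 5 i' = s.idx 5 i') ∧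
      ∀ j < v, s'.idx 5 i (m + j) = j) 30 m ?_ ?_ (i := 0) (Nat.zero_le m) ?_).mono ?_
  · rintro v s' ⟨h9, -, hi, -⟩
    simp [h9, hi 1 (by simp), h1]
  · rintro v s₁ hv ⟨h9, hr, hi, ho, hW⟩
    have e1 : s₁.idx 1 0 0 = m := by rw [hi 1 (by simp), h1]
    have e8 : s₁.idx 8 0 0 = i := by rw [hi 8 (by simp), h8]
    simp only [total_seq, total_setIdx, IdxExpr.eval, IdxExpr.cost, e1, e8, h9]
    refine ⟨by norm_num, ?_, hr, ?_, ?_, ?_⟩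
    · simp [h9]
    · intro a ha
      rw [← hi a ha]
      simp only [List.mem_cons, List.not_mem_nil, or_false, not_or] at ha
      simp [ha]
    · intro i' hi'
      rw [← ho i' hi']
      funext v'
      simp [hi']
    · intro j hj
      simp only [ne_eq, Nat.reduceEqDiff, not_false_eq_true, write_other, write_same, true_and]
      rcases Nat.lt_succ_iff_lt_or_eq.1 hj with h | h
      · rw [if_neg (by omega)]
        exact hW j h
      · rw [if_pos (by omega), h]
  · refine ⟨by simp, rfl, ?_, ?_, by simp⟩
    · intro a ha
      simp only [List.mem_cons, List.not_mem_nil, or_false, not_or] at ha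
      simp [ha]
    · intro i' _
      simp
  · rintro t₁ s₁ ⟨ht₁, h9, hr₁, hi₁, ho₁, hW₁⟩
    have e1 : s₁.idx 1 0 0 = m := by rw [hi₁ 1 (by simp), h1]
    have e8 : s₁.idx 8 0 0 = i := by rw [hi₁ 8 (by simp), h8]
    rw [total_seq, total_setIdx, total_seq]
    refine (total_loop_count (fun v s' => s'.idx 9 0 0 = m - 1 - v ∧ s'.real = s.real ∧
      (∀ a, a ∉ [5, 9] → s'.idx a = s.idx a) ∧ (∀ i', i' ≠ i → s'.idx 5 i' = s.idx 5 i') ∧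
      PartialTournament m (fun j => s.real 2 i j / (s.real 4 j 0 + s.real 3 i j)) (s'.idx 5 i)
        (m - 1 - v)) 220 (m - 1) ?_ ?_ (i := 0) (Nat.zero_le _) ?_).mono ?_
    · rintro v s' ⟨h9, -⟩
      simp only [Test.Holds, IdxExpr.eval, h9]
      omega
    · rintro v s₂ hv ⟨h9₂, hr₂, hi₂, ho₂, hT₂⟩
      rw [total_seq]
      refine (replayMatch_spec (i := i) (v := m - 1 - v)
        (val := fun j => s.real 2 i j / (s.real 4 j 0 + s.real 3 i j))
        (by rw [hi₂ 8 (by simp), h8]) h9₂ (by rw [hr₂]; exact fun _ => rfl)).mono ?_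
      rintro t₃ s₃ ⟨ht₃, hr₃, hi₃, ho₃, hW₃⟩
      have h9₃ : s₃.idx 9 0 0 = m - 1 - v := by rw [hi₃ 9 (by simp), h9₂]
      simp only [total_setIdx, IdxExpr.eval, IdxExpr.cost, h9₃]
      refine ⟨by omega, ?_, by rw [hr₃, hr₂], ?_, ?_, ?_⟩
      · rw [write_same, if_pos ⟨rfl, rfl⟩, Nat.sub_sub]
      · intro a ha
        have ha' := ha
        simp only [List.mem_cons, List.not_mem_nil, or_false, not_or] at ha'
        rw [write_other _ ha'.2, hi₃ a ha'.1, hi₂ a ha]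
      · intro i' hi'
        rw [write_other _ (by simp), ho₃ i' hi', ho₂ i' hi']
      · rw [write_other _ (by simp), ← Nat.sub_sub]
        exact hT₂.replay (by omega) (by omega) hW₃
    · refine ⟨by simp [e1], hr₁, ?_, ?_, ?_⟩
      · intro a ha
        rw [← hi₁ a ha]
        simp only [List.mem_cons, List.not_mem_nil, or_false, not_or] at ha
        simp [ha]
      · intro i' hi'
        rw [← ho₁ i' hi']
        simp
      · simpa using PartialTournament.leaves hW₁
    · rintro t₄ s₄ ⟨ht₄, h9₄, hr₄, hi₄, ho₄, hT₄⟩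
      have e8₄ : s₄.idx 8 0 0 = i := by rw [hi₄ 8 (by simp), h8]
      simp only [total_setIdx, IdxExpr.eval, IdxExpr.cost, Test.cost, e8₄] at ht₁ ht₄ ⊢
      refine ⟨by omega, hr₄, by simp, ?_, ?_, ?_⟩
      · intro a ha
        simp only [List.mem_cons, List.not_mem_nil, or_false, not_or] at ha
        rw [write_other _ ha.2.1, hi₄ a (by simp [ha])]
      · intro i' hi'
        rw [write_other _ (by simp), ho₄ i' hi']
      · rw [write_other _ (by simp)]
        rw [Nat.sub_self] at hT₄
        exact hT₄.tournament

/-- The opening memory satisfies the invariant of the auction. -/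
theorem setUp_spec (hm : 1 ≤ m) (hε : 0 < ε) (hu : ∀ i j, 0 ≤ s.real 2 i j)
    (hc : ∀ i j, 0 ≤ s.real 3 i j) (h0 : s.idx 0 0 0 = n) (h1 : s.idx 1 0 0 = m)
    (h4 : ∀ j, s.idx 4 j 0 = 0) (h8 : s.idx 8 0 0 = 0) (r0 : s.real 0 0 0 = ε)
    (r5 : s.real 5 = fun _ _ => 0) (r6 : s.real 6 = fun _ _ => 0) :
    Total setUp (fun t s' => t ≤ m * 60 + n * (m * 280 + 110) + 50 ∧
      Good n m ε (s.real 2) (s.real 3) (fun i => s.real 1 i 0) (fun _ => 0) s' ∧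
      s'.real 1 = s.real 1 ∧ ∀ i ≤ n, ∀ j < m, s'.real 6 i j = if i = n then 1 else 0) s := by
  rw [setUp, total_seq]
  refine (total_loop_count (fun v s' => s'.idx 8 0 0 = v ∧
      (∀ a, a ≠ 8 → s'.idx a = s.idx a) ∧ (∀ a, a ∉ [4, 6] → s'.real a = s.real a) ∧
      (∀ j < v, s'.real 4 j 0 = ε) ∧
      ∀ k l, s'.real 6 k l = if k = n ∧ l < v then 1 else 0) 40 m ?_ ?_ (i := 0) (Nat.zero_le m)
      ⟨h8, fun _ _ => rfl, fun _ _ => rfl, by simp, by simp [r6]⟩).mono ?_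
  · rintro v s' ⟨h8, hi, -⟩
    simp [h8, hi 1 (by simp), h1]
  · rintro v s₁ hv ⟨h8₁, hi, hr, hp, hh⟩
    have e0 : s₁.idx 0 0 0 = n := by rw [hi 0 (by simp), h0]
    have f0 : s₁.real 0 0 0 = ε := by rw [hr 0 (by simp), r0]
    simp only [total_seq, total_setReal, total_setIdx, IdxExpr.eval, IdxExpr.cost, RealExpr.eval,
      RealExpr.cost, h8₁, e0, f0]
    refine ⟨by norm_num, by simp, fun a ha => ?_, ?_, ?_, ?_⟩
    · rw [write_other _ ha, hi a ha]
    · intro a ha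
      rw [← hr a ha]
      simp only [List.mem_cons, List.not_mem_nil, or_false, not_or] at ha
      simp [ha]
    · intro j hj
      simp only [ne_eq, Nat.reduceEqDiff, not_false_eq_true, write_other, write_same, and_true]
      split_ifs with h
      · rfl
      · exact hp j (by omega)
    · intro k l
      simp only [write_same, ne_eq, Nat.reduceEqDiff, not_false_eq_true, write_other, hh,
        Nat.cast_one]
      by_cases hk : k = n
      · by_cases hl : l = v
        · simp [hk, hl]
        · have : l < v + 1 ↔ l < v := by omega
          simp [hk, hl, this]
      · simp [hk]
  · rintro t₁ s₁ ⟨ht₁, h8₁, hi₁, hr₁, hp₁, hh₁⟩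
    have e0 : s₁.idx 0 0 0 = n := by rw [hi₁ 0 (by simp), h0]
    have e1 : s₁.idx 1 0 0 = m := by rw [hi₁ 1 (by simp), h1]
    rw [total_seq, total_setIdx]
    refine (total_loop_count (fun i s' => s'.idx 8 0 0 = i ∧ s'.real = s₁.real ∧
      (∀ a, a ∉ [5, 8, 9] → s'.idx a = s₁.idx a) ∧ ∀ i' < i, Tournament m
        (fun j => s₁.real 2 i' j / (s₁.real 4 j 0 + s₁.real 3 i' j)) (s'.idx 5 i') 0)
      (m * 280 + 100) n ?_ ?_ (i := 0) (Nat.zero_le n) ?_).mono ?_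
    · rintro i s' ⟨h8, -, hi, -⟩
      simp [h8, hi 0 (by simp), e0]
    · rintro i s₂ hi ⟨h8₂, hr₂, hi₂, hT₂⟩
      refine (build_row_spec hm (by rw [hi₂ 1 (by simp), e1]) h8₂).mono ?_
      rintro t₃ s₃ ⟨ht₃, hr₃, h8₃, hi₃, ho₃, hT₃⟩
      refine ⟨ht₃, h8₃, by rw [hr₃, hr₂], fun a ha => (hi₃ a ha).trans (hi₂ a ha), ?_⟩
      intro i' hi'
      rcases Nat.lt_succ_iff_lt_or_eq.1 hi' with h | h
      · rw [ho₃ i' h.ne]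
        exact hT₂ i' h
      · rw [h, ← hr₂]
        exact hT₃
    · refine ⟨by simp, rfl, fun a ha => ?_, by simp⟩
      simp only [List.mem_cons, List.not_mem_nil, or_false, not_or] at ha
      simp [ha]
    · rintro t₄ s₄ ⟨ht₄, -, hr₄, hi₄, hT₄⟩
      simp only [IdxExpr.cost, Test.cost] at ht₁ ht₄ ⊢
      have g1 : s₄.real 1 = s.real 1 := by rw [hr₄, hr₁ 1 (by simp)]
      have g2 : s₄.real 2 = s.real 2 := by rw [hr₄, hr₁ 2 (by simp)]
      have g3 : s₄.real 3 = s.real 3 := by rw [hr₄, hr₁ 3 (by simp)]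
      have g5 : s₄.real 5 = fun _ _ => 0 := by rw [hr₄, hr₁ 5 (by simp), r5]
      have g4 : ∀ j, s₄.idx 4 j 0 = 0 := fun j => by
        rw [hi₄ 4 (by simp), hi₁ 4 (by simp), h4]
      have hh₄ : ∀ i ≤ n, ∀ j < m, s₄.real 6 i j = if i = n then 1 else 0 := by
        intro i _ j hj
        rw [hr₄, hh₁]
        simp [hj]
      refine ⟨?_, ⟨hm, hε, hu, hc, by rw [hi₄ 0 (by simp), e0], by rw [hi₄ 1 (by simp), e1],
        by rw [hr₄, hr₁ 0 (by simp), r0], g2, g3, ?_, ?_, ?_, ?_⟩, g1, hh₄⟩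
      · have h5 : n * (m * 280 + 100 + 1 + 7) ≤ n * (m * 280 + 110) :=
          Nat.mul_le_mul_left _ (by omega)
        norm_num at ht₁ ht₄ h5 ⊢
        omega
      · rw [g5, g1]
        refine Auction.opening n m ε _ _ _ (fun j hj => ?_) hh₄
        rw [hr₄]
        exact hp₁ j hj
      · intro i hi
        have := hT₄ i hi
        rw [hr₄]
        rwa [hr₁ 2 (by simp), hr₁ 3 (by simp)] at this
      · intro j _
        rw [g4]
        omega
      · intro j _ k hk
        rw [g4] at hk
        omega

/-! ### Settling -/

theorem settle_spec (h0 : s.idx 0 0 0 = n) (h1 : s.idx 1 0 0 = m) (r0 : s.real 0 0 0 = ε) :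
    Total settle (fun t s' => t ≤ n * (m * 150 + 50) + 20 ∧ s'.real 4 = s.real 4 ∧
      ∀ i < n, ∀ j < m, s'.real 5 i j = s.real 5 i j + s.real 6 i j *
        ((s.real 4 j 0 / (1 + ε) + s.real 3 i j) / (s.real 4 j 0 + s.real 3 i j))) s := by
  rw [settle, total_seq, total_setIdx]
  refine (total_loop_count (fun i s' => s'.idx 8 0 0 = i ∧
      (∀ a, a ∉ [8, 9] → s'.idx a = s.idx a) ∧ (∀ a, a ≠ 5 → s'.real a = s.real a) ∧
      ∀ i' j, j < m → s'.real 5 i' j = s.real 5 i' j + if i' < i then s.real 6 i' j *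
        ((s.real 4 j 0 / (1 + ε) + s.real 3 i' j) / (s.real 4 j 0 + s.real 3 i' j)) else 0)
      (m * 150 + 40) n ?_ ?_ (i := 0) (Nat.zero_le n) ?_).mono ?_
  · rintro i s' ⟨h8, hi, -⟩
    simp [h8, hi 0 (by simp), h0]
  · rintro i s₁ hin ⟨h8, hi₁, hr₁, hx₁⟩
    rw [total_seq, total_setIdx, total_seq]
    refine (total_loop_count (fun v s' => s'.idx 9 0 0 = v ∧ s'.idx 8 0 0 = i ∧
      (∀ a, a ∉ [8, 9] → s'.idx a = s.idx a) ∧ (∀ a, a ≠ 5 → s'.real a = s.real a) ∧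
      ∀ i' j, j < m → s'.real 5 i' j = s.real 5 i' j +
        if i' < i ∨ i' = i ∧ j < v then s.real 6 i' j *
        ((s.real 4 j 0 / (1 + ε) + s.real 3 i' j) / (s.real 4 j 0 + s.real 3 i' j)) else 0)
      140 m ?_ ?_ (i := 0) (Nat.zero_le m) ?_).mono ?_
    · rintro v s' ⟨h9, -, hi, -⟩
      simp [h9, hi 1 (by simp), h1]
    · rintro v s₂ hv ⟨h9₂, h8₂, hi₂, hr₂, hx₂⟩
      simp only [total_seq, total_setIdx, total_setReal, IdxExpr.eval, RealExpr.eval,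
        IdxExpr.cost, RealExpr.cost, h8₂, h9₂, hr₂ 6 (by simp), hr₂ 4 (by simp),
        hr₂ 3 (by simp), hr₂ 0 (by simp), r0, Nat.cast_one]
      refine ⟨by norm_num, by simp, by simp [h8₂], fun a ha => ?_, fun a ha => ?_, ?_⟩
      · rw [← hi₂ a ha]
        simp only [List.mem_cons, List.not_mem_nil, or_false, not_or] at ha
        simp [ha]
      · rw [write_other _ ha, hr₂ a ha]
      · intro i' j hj
        rw [write_same]
        by_cases h : i' = i ∧ j = v
        · rw [if_pos h, hx₂ i v hv, h.1, h.2]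
          simp
        · have h' : (i' < i ∨ i' = i ∧ j < v + 1) ↔ (i' < i ∨ i' = i ∧ j < v) := by omega
          rw [if_neg h, hx₂ i' j hj]
          simp only [h']
    · refine ⟨by simp, by simp [h8], fun a ha => ?_, hr₁, by simpa using hx₁⟩
      rw [← hi₁ a ha]
      simp only [List.mem_cons, List.not_mem_nil, or_false, not_or] at ha
      simp [ha]
    · rintro t₃ s₃ ⟨ht₃, h9₃, h8₃, hi₃, hr₃, hx₃⟩
      simp only [total_setIdx, IdxExpr.eval, IdxExpr.cost, Test.cost, h8₃] at ht₃ ⊢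
      refine ⟨by omega, by simp, fun a ha => ?_, hr₃, ?_⟩
      · have ha' := ha
        simp only [List.mem_cons, List.not_mem_nil, or_false, not_or] at ha'
        rw [write_other _ ha'.1, hi₃ a ha]
      · intro i' j hj
        have h : i' < i + 1 ↔ (i' < i ∨ i' = i ∧ j < m) := by omega
        simp only [h]
        exact hx₃ i' j hj
  · refine ⟨by simp, fun a ha => ?_, fun _ _ => rfl, by simp⟩
    simp only [List.mem_cons, List.not_mem_nil, or_false, not_or] at ha
    simp [ha]
  · rintro t s' ⟨ht, -, -, hr, hx⟩
    simp only [IdxExpr.cost, Test.cost] at ht ⊢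
    refine ⟨?_, hr 4 (by simp), fun i hi j hj => ?_⟩
    · have h5 : n * (m * 150 + 40 + 1 + 7) ≤ n * (m * 150 + 50) :=
        Nat.mul_le_mul_left _ (by omega)
      norm_num at ht h5 ⊢
      omega
    · rw [hx i j hj, if_pos hi]

end

/-! ### The bound on the number of operations -/

/-- The number of raises of a good, each by the factor `1 + ε`, that lead from the price `ε` to at
most `b`. -/
noncomputable def maxRaises (ε b : ℝ) : ℕ := ⌊max 0 (Real.log (b / ε)) / Real.log (1 + ε)⌋₊

theorem le_maxRaises {ε b : ℝ} (hε : 0 < ε) {k : ℕ} (hk : k = 0 ∨ ε * (1 + ε) ^ k ≤ b) :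
    k ≤ maxRaises ε b := by
  rcases hk with rfl | hk
  · exact Nat.zero_le _
  · have hlog : 0 < Real.log (1 + ε) := Real.log_pos (by linarith)
    refine Nat.le_floor ?_
    rw [le_div_iff₀ hlog, ← Real.log_pow]
    refine le_max_of_le_right (Real.log_le_log (by positivity) ?_)
    rw [le_div_iff₀ hε]
    linarith

theorem le_log_one_add {ε : ℝ} (hε : 0 < ε) : ε / (1 + ε) ≤ Real.log (1 + ε) := by
  have h := Real.one_sub_inv_le_log_of_pos (show 0 < 1 + ε by linarith)
  have h1 : ε / (1 + ε) = 1 - (1 + ε)⁻¹ := by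
    field_simp
    ring
  rw [h1]
  exact h

theorem maxRaises_le {ε b : ℝ} (hε : 0 < ε) :
    (maxRaises ε b : ℝ) ≤ 2 * (max 1 (1 / ε) * max 0 (Real.log (b / ε))) := by
  have hlog : 0 < Real.log (1 + ε) := Real.log_pos (by linarith)
  have h0 : 0 ≤ max 0 (Real.log (b / ε)) := le_max_left _ _
  refine (Nat.floor_le (div_nonneg h0 hlog.le)).trans ?_
  have h1 : 1 / Real.log (1 + ε) ≤ 2 * max 1 (1 / ε) := by
    refine (one_div_le_one_div_of_le (by positivity) (le_log_one_add hε)).trans ?_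
    have h2 : 1 / (ε / (1 + ε)) = 1 + 1 / ε := by
      field_simp
      ring
    rw [h2]
    linarith [le_max_left 1 (1 / ε), le_max_right 1 (1 / ε)]
  rw [div_eq_mul_one_div]
  calc max 0 (Real.log (b / ε)) * (1 / Real.log (1 + ε))
      ≤ max 0 (Real.log (b / ε)) * (2 * max 1 (1 / ε)) := mul_le_mul_of_nonneg_left h1 h0
    _ = _ := by ring

theorem log_two_le (m : ℕ) (hm : 1 ≤ m) : (Nat.log 2 m : ℝ) ≤ 2 * Real.log m := by
  have h1 : ((2 : ℝ)) ^ Nat.log 2 m ≤ m := by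
    exact_mod_cast Nat.pow_log_le_self 2 (by omega)
  have h2 := Real.log_le_log (by positivity) h1
  rw [Real.log_pow] at h2
  have h3 : (1 / 2 : ℝ) ≤ Real.log 2 := by linarith [Real.log_two_gt_d9]
  have h4 : (0 : ℝ) ≤ Nat.log 2 m := Nat.cast_nonneg _
  nlinarith

/-- The program computes an approximate equilibrium within the operations that the setting up, the
initial potential and the settling account for. -/
theorem marketProg_spec {n m : ℕ} (hm : 1 ≤ m) (M : FisherMarket n m) {ε : ℝ} (hε : 0 < ε) {L : ℕ}
    (hL : m ≤ 2 ^ L) :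
    Total marketProg (fun t s =>
      M.IsApproxEquilibrium ε (outPrice s m) (outAlloc s n m) ∧
      t ≤ potential n L (m * maxRaises ε ((1 + ε) * ∑ i, M.budget i)) m (m * (n + 1)) n +
        n * (m * 430) + 60 * m + 1190 * n + 140) (input M ε) := by
  have hB : ∑ i ∈ Finset.range n, (input M ε).real 1 i 0 = ∑ i, M.budget i := by
    rw [Finset.sum_range]
    refine Finset.sum_congr rfl fun i _ => ?_
    simp [input]
  have hbud : ∀ i < n, 0 ≤ (input M ε).real 1 i 0 := by
    intro i hi
    simp only [input, and_true, hi, dif_pos]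
    exact M.budget_nonneg _
  rw [marketProg, total_seq]
  refine (setUp_spec (n := n) (m := m) (ε := ε) hm hε ?_ ?_ (by simp [input]) (by simp [input])
    (by simp [input]) (by simp [input]) (by simp [input]) rfl rfl).mono ?_
  · intro i j
    simp only [input]
    split_ifs
    · exact M.util_nonneg _ _
    · exact le_rfl
  · intro i j
    simp only [input]
    split_ifs
    · exact M.tcost_nonneg _ _
    · exact le_rfl
  rintro t₁ s₁ ⟨ht₁, hG₁, hr₁, hh₁⟩
  rw [total_seq]
  refine (rescan_spec hG₁.n_eq).mono ?_
  rintro t₂ s₂ ⟨ht₂, hr₂, hi₂, h3₂, hcase⟩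
  rw [← hr₂] at hcase
  have hG₂ := hG₁.congr (s' := s₂) (by
    intro a ha
    simp only [List.mem_cons, List.not_mem_nil, or_false] at ha
    rcases ha with rfl | rfl | rfl | rfl <;> exact hi₂ _ (by simp)) (by simp [hr₂])
  rw [total_seq]
  refine (hG₂.auction_loop hL (K := maxRaises ε ((1 + ε) * ∑ i, M.budget i)) (fun k hk =>
    le_maxRaises hε (by rwa [hB] at hk)) (by rw [hr₂, hr₁]; exact hbud) h3₂ hcase).mono ?_
  rintro t₃ s₃ ⟨ht₃, e, hG₃, hr₃⟩
  refine (settle_spec hG₃.n_eq hG₃.m_eq hG₃.eps_eq).mono ?_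
  rintro t₄ s₄ ⟨ht₄, hp₄, hx₄⟩
  constructor
  · have h := hG₃.auction.isApproxEquilibrium hm M hε hr₃ (fun i j => by simp [input])
      (fun i j => by simp [input]) (fun i => by simp [input]) (x := s₄.real 5) (by
        intro i hi j hj
        rw [hx₄ i hi j hj, hG₃.cost_eq])
    rw [← hp₄] at h
    exact h
  · have hpot : s₂.pot n m (maxRaises ε ((1 + ε) * ∑ i, M.budget i)) L (fun _ => 0) ≤
        potential n L (m * maxRaises ε ((1 + ε) * ∑ i, M.budget i)) m (m * (n + 1)) n := by
      refine potential_mono (by simp) ?_ ?_ ?_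
      · have hsub : held n m (s₂.real 6) ⊆ {n} ×ˢ Finset.range m := by
          rintro ⟨k, j⟩ hx
          obtain ⟨⟨hk, hj⟩, h0⟩ := mem_held.1 hx
          rw [hr₂, hh₁ k hk j hj] at h0
          rw [Finset.mem_product]
          refine ⟨Finset.mem_singleton.2 ?_, Finset.mem_range.2 hj⟩
          by_contra h
          simp [h] at h0
        refine (Finset.card_le_card hsub).trans ?_
        simp
      · refine (Finset.sum_le_card_nsmul _ _ (n + 1) fun j _ => Nat.sub_le _ _).trans ?_
        simp
      · exact (Finset.card_filter_le _ _).trans (by simp)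
    have e1 : n * (m * 280 + 110) = n * (m * 280) + 110 * n := by ring
    have e2 : n * (m * 150 + 50) = n * (m * 150) + 50 * n := by ring
    have e3 : n * (m * 430) = n * (m * 280) + n * (m * 150) := by ring
    omega

theorem operations_le {n m K : ℕ} (hn : 1 ≤ n) (hm : 1 ≤ m) {t : ℕ}
    (ht : t ≤ potential n (Nat.log 2 m + 1) (m * K) m (m * (n + 1)) n + n * (m * 430) + 60 * m +
      1190 * n + 140) :
    (t : ℝ) ≤ (((n : ℝ) + Real.log m) * m * n) * (160000 * K + 60000) := by
  have hlog := log_two_le m hm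
  have hlog0 : 0 ≤ Real.log m := Real.log_natCast_nonneg m
  have hn' : (1 : ℝ) ≤ n := by exact_mod_cast hn
  have hm' : (1 : ℝ) ≤ m := by exact_mod_cast hm
  have hK : (0 : ℝ) ≤ K := Nat.cast_nonneg K
  have ht' : (t : ℝ) ≤ 20000 * ((n + 1) * (n + 1 + (Nat.log 2 m + 1))) * (m * K) +
      6000 * (n + 1) * m + 3000 * (n + 1) * (m * (n + 1)) + 3000 * (n + 1) * n +
      n * (m * 430) + 60 * m + 1190 * n + 140 := by
    have := (Nat.cast_le (α := ℝ)).2 ht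
    simpa only [potential, Nat.cast_add, Nat.cast_mul, Nat.cast_ofNat, Nat.cast_one] using this
  set X : ℝ := ((n : ℝ) + Real.log m) * m * n with hX
  have h1 : (n : ℝ) * m * n ≤ X := by
    rw [hX]
    gcongr
    linarith
  have hmn : (m : ℝ) * n ≤ n * m * n := by
    rw [mul_assoc]
    exact le_mul_of_one_le_left (by positivity) hn'
  have hnn : (n : ℝ) * n ≤ n * m * n := by
    gcongr
    exact le_mul_of_one_le_right (by positivity) hm'
  have hmle : (m : ℝ) ≤ m * n := le_mul_of_one_le_right (by linarith) hn'
  have hnle : (n : ℝ) ≤ m * n := le_mul_of_one_le_left (by linarith) hm'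
  have hmain : ((n : ℝ) + 1) * (n + 1 + (Nat.log 2 m + 1)) * (m * K) ≤ 6 * X * K := by
    have a1 : (n : ℝ) + 1 ≤ 2 * n := by linarith
    have a2 : (n : ℝ) + 1 + (Nat.log 2 m + 1) ≤ 3 * (n + Real.log m) := by linarith
    calc ((n : ℝ) + 1) * (n + 1 + (Nat.log 2 m + 1)) * (m * K)
        ≤ (2 * n) * (3 * (n + Real.log m)) * (m * K) := by gcongr
      _ = 6 * X * K := by rw [hX]; ring
  have hXK : 0 ≤ X * K := by positivity
  nlinarith

end RealRAM

theorem theorem1 :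
    ∃ (P : RealRAM.Prog) (C : ℝ),
      ∀ (n m : ℕ), 1 ≤ n → 1 ≤ m → ∀ (M : FisherMarket n m) (ε : ℝ), 0 < ε →
        ∃ (t : ℕ) (s : RealRAM.State),
          RealRAM.Exec P (RealRAM.input M ε) t s ∧
          M.IsApproxEquilibrium ε (RealRAM.outPrice s m) (RealRAM.outAlloc s n m) ∧
          (t : ℝ) ≤ C * (((n : ℝ) + Real.log m) * m * n *
            (1 + max 1 (1 / ε) * max 0 (Real.log (((1 + ε) * ∑ i, M.budget i) / ε)))) ∧
          (ε ≤ 1 → ε ≤ ∑ i, M.budget i →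
            (t : ℝ) ≤ C * (1 / ε * ((n : ℝ) + Real.log m) * m * n *
              Real.log (((1 + ε) * ∑ i, M.budget i) / ε))) := by
  refine ⟨RealRAM.marketProg, 960000, fun n m hn hm M ε hε => ?_⟩
  obtain ⟨t, s, hexec, heq, ht⟩ :=
    RealRAM.marketProg_spec hm M hε (Nat.lt_pow_succ_log_self one_lt_two m).le
  have ht := RealRAM.operations_le hn hm ht
  have hK := RealRAM.maxRaises_le (b := (1 + ε) * ∑ i, M.budget i) hε
  set Y : ℝ := max 1 (1 / ε) * max 0 (Real.log (((1 + ε) * ∑ i, M.budget i) / ε)) with hY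
  set X : ℝ := ((n : ℝ) + Real.log m) * m * n with hX
  have hlog0 : 0 ≤ Real.log m := Real.log_natCast_nonneg m
  have hX0 : 0 ≤ X := by positivity
  have hY0 : 0 ≤ Y := by positivity
  have hbound : (t : ℝ) ≤ 320000 * (X * (1 + Y)) := by
    refine ht.trans ?_
    calc X * (160000 * RealRAM.maxRaises ε ((1 + ε) * ∑ i, M.budget i) + 60000)
        ≤ X * (160000 * (2 * Y) + 320000) := by
          refine mul_le_mul_of_nonneg_left ?_ hX0
          linarith
      _ = 320000 * (X * (1 + Y)) := by ring
  refine ⟨t, s, hexec, heq, ?_, fun h1 h2 => ?_⟩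
  · have : 0 ≤ X * (1 + Y) := by positivity
    linarith
  · -- here `log (B / ε) ≥ log (1 + ε) ≥ ε / 2`, so that `Y` is at least `1 / 2`
    have hle : 1 + ε ≤ ((1 + ε) * ∑ i, M.budget i) / ε := by
      rw [le_div_iff₀ hε]
      exact mul_le_mul_of_nonneg_left h2 (by linarith)
    have hlog : ε / (1 + ε) ≤ Real.log (((1 + ε) * ∑ i, M.budget i) / ε) :=
      (RealRAM.le_log_one_add hε).trans (Real.log_le_log (by linarith) hle)
    have hpos : 0 ≤ Real.log (((1 + ε) * ∑ i, M.budget i) / ε) :=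
      le_trans (by positivity) hlog
    have hYeq : Y = 1 / ε * Real.log (((1 + ε) * ∑ i, M.budget i) / ε) := by
      rw [hY, max_eq_right hpos, max_eq_right]
      rw [le_div_iff₀ hε]
      linarith
    have hYhalf : 1 ≤ 2 * Y := by
      have h3 : 1 / ε * (ε / (1 + ε)) ≤ Y := by
        rw [hYeq]
        exact mul_le_mul_of_nonneg_left hlog (by positivity)
      have h4 : 1 / ε * (ε / (1 + ε)) = 1 / (1 + ε) := by
        field_simp
      have h5 : 1 / 2 ≤ 1 / (1 + ε) := one_div_le_one_div_of_le (by linarith) (by linarith)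
      linarith
    calc (t : ℝ) ≤ 320000 * (X * (1 + Y)) := hbound
      _ ≤ 320000 * (X * (2 * Y + Y)) := by gcongr
      _ = 960000 * (1 / ε * ((n : ℝ) + Real.log m) * m * n *
          Real.log (((1 + ε) * ∑ i, M.budget i) / ε)) := by
        rw [hYeq, hX]
        ring
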